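/- Let $(\mathcal X,d)$ be a compact metric space (for instance a compact convex set), $\mathcal M^+(\mathcal X)$ the finite positive Borel measures on $\mathcal X$, $m(\alpha)=\alpha(\mathcal X)$, and let $\varepsilon>0$. Let $C:\mathcal X\times\mathcal X\to\mathbb R$ be continuous and symmetric with $C(x,x)=0$ and $|C(x,z)-C(y,z)|\le\gamma\,d(x,y)$ for all $x,y,z$ and some $\gamma\ge 0$. Let $\phi:[0,\infty)\to[0,\infty]$ be convex and lower semicontinuous with $\phi(1)=0$; put $\phi'_\infty=\lim_{p\to\infty}\phi(p)/p$, $\phi^*(q)=\sup_{p\ge0}(pq-\phi(p))$, and, with the Lebesgue decomposition $\mu=\frac{d\mu}{d\nu}\nu+\mu^\perp$, $D_\phi(\mu|\nu)=\int\phi\big(\frac{d\mu}{d\nu}\big)d\nu+\phi'_\infty\,\mu^\perp(\mathcal X)$ (with $\infty\cdot 0=0$). Assume: (1) $\phi^*$ is strictly convex on its domain $\{\phi^*<\infty\}$; (2) there are $x_n\in\operatorname{dom}\phi^*$ and $s_n\in\partial\phi^*(x_n)$ such that $s_n\to0$ or $s_n\to+\infty$. For $\alpha,\beta\in\mathcal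 M^+(\mathcal X)$ define $$\mathrm{OT}_\varepsilon(\alpha,\beta)=\inf_{\pi\in\mathcal M^+(\mathcal X^2)}\int C\,d\pi+D_\phi(\pi_1|\alpha)+D_\phi(\pi_2|\beta)+\varepsilon\,\mathrm{KL}(\pi|\alpha\otimes\beta),$$ where $\pi_1,\pi_2$ are the marginals of $\pi$ and $\mathrm{KL}(\mu|\nu)=D_\psi(\mu|\nu)$ for $\psi(p)=p\log p-p+1$, $$S_\varepsilon(\alpha,\beta)=\mathrm{OT}_\varepsilon(\alpha,\beta)-\tfrac12\mathrm{OT}_\varepsilon(\alpha,\alpha)-\tfrac12\mathrm{OT}_\varepsilon(\beta,\beta)+\tfrac\varepsilon2\big(m(\alpha)-m(\beta)\big)^2,$$ $$F_\varepsilon(\alpha)=-\sup_{f\in\mathcal C(\mathcal X)}\Big(\int-\phi^*(-f)\,d\alpha-\tfrac\varepsilon2\iint e^{(f(x)+f(y)-C(x,y))/\varepsilon}\,d\alpha(x)\,d\alpha(y)\Big).$$ A function $\nabla F_\varepsilon(\alpha)\in\mathcal C(\mathcal X)$ is the gradient of $F_\varepsilon$ at $\alpha$ if $F_\varepsilon(\alpha)$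 is finite and, for every finite signed Borel measure $\delta$, $F_\varepsilon(\alpha+t\delta)=F_\varepsilon(\alpha)+t\int\nabla F_\varepsilon(\alpha)\,d\delta+o(t)$ as $t\to0$ along the real $t$ with $\alpha+t\delta\in\mathcal M^+(\mathcal X)$; it is unique if it exists. Then for all nonzero $\alpha,\beta\in\mathcal M^+(\mathcal X)$: $\mathrm{OT}_\varepsilon(\alpha,\beta)$ is finite (hence so is $S_\varepsilon(\alpha,\beta)$), $F_\varepsilon$ has a gradient at $\alpha$ and at $\beta$, and the Hausdorff divergence (the symmetric Bregman divergence of $F_\varepsilon$) $$H_\varepsilon(\alpha,\beta)=\int\big(\nabla F_\varepsilon(\alpha)-\nabla F_\varepsilon(\beta)\big)\,d(\alpha-\beta)$$ satisfies $$S_\varepsilon(\alpha,\beta)\ge\tfrac12H_\varepsilon(\alpha,\beta).$$ If moreover the kernel $k_\varepsilon=e^{-C/\varepsilon}$ is positive, i.e. $\iint k_\varepsilon\,d\delta\,d\delta\ge0$ for every finite signed Borel measure $\delta$ on $\mathcal X$, then also $$\tfrac12H_\varepsilon(\alpha,\beta)\ge0,\qquad\text{so that}\qquad S_\varepsilon(\alpha,\beta)\ge\tfrac12H_\varepsilon(\alpha,\beta)\ge0.$$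 -/

import Mathlib

open MeasureTheory Set Filter Topology
open scoped NNReal ENNReal

namespace UnbalancedOT

noncomputable section

/-! ### Entropy functions and Csiszár divergences -/

/-- Entropy functions: convex, lower semicontinuous `φ : [0,∞) → [0,∞]` with `φ 1 = 0`. -/
structure IsEntropyFunction (φ : ℝ≥0 → ℝ≥0∞) : Prop where
  convexOn : ConvexOn ℝ≥0 univ φ
  lowerSemicontinuous : LowerSemicontinuous φ
  map_one : φ 1 = 0

/-- The recession constant `φ'_∞ = lim_{p → ∞} φ p / p`. For a convex `φ` the limit exists
in `[0,∞]`, so that it is the upper limit. -/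
def recession (φ : ℝ≥0 → ℝ≥0∞) : ℝ≥0∞ :=
  limsup (fun p : ℝ≥0 => φ p / (p : ℝ≥0∞)) atTop

/-- The `φ`-divergence `D_φ(μ|ν) = ∫ φ(dμ/dν) dν + φ'_∞ μ^⊥(Y)`, where
`μ = (dμ/dν) ν + μ^⊥` is the Lebesgue decomposition, with the convention `∞ * 0 = 0`. -/
def csiszarDiv {Y : Type*} [MeasurableSpace Y] (φ : ℝ≥0 → ℝ≥0∞) (μ ν : Measure Y) : ℝ≥0∞ :=
  ∫⁻ y, φ (μ.rnDeriv ν y).toNNReal ∂ν + recession φ * μ.singularPart ν univ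

/-- The Legendre conjugate `φ^*(q) = sup_{p ≥ 0} (p q - φ p)`, with values in `(-∞,∞]`. -/
def conj (φ : ℝ≥0 → ℝ≥0∞) (q : ℝ) : EReal :=
  ⨆ p : ℝ≥0, (((p : ℝ) * q : ℝ) : EReal) - ((φ p : ℝ≥0∞) : EReal)

/-- The effective domain of `φ^*`. -/
def conjDom (φ : ℝ≥0 → ℝ≥0∞) : Set ℝ := {q | conj φ q ≠ ⊤}

/-- `s` is a subgradient of `φ^*` at `x`; used for `x` in the domain of `φ^*`. -/
def IsConjSubgradient (φ : ℝ≥0 → ℝ≥0∞) (x s : ℝ) : Prop :=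
  ∀ y : ℝ, conj φ x + ((s * (y - x) : ℝ) : EReal) ≤ conj φ y

/-- The conjugate `φ^*` is strictly convex (on its domain). -/
def ConjStrictlyConvex (φ : ℝ≥0 → ℝ≥0∞) : Prop :=
  StrictConvexOn ℝ (conjDom φ) (fun q => (conj φ q).toReal)

/-- There are a sequence `x n` in the domain of `φ^*` and subgradients `s n ∈ ∂φ^*(x n)` such
that `s n` converges to `0` or to `+∞`. -/
def ConjExtremeSlopes (φ : ℝ≥0 → ℝ≥0∞) : Prop :=
  ∃ x s : ℕ → ℝ, (∀ n, x n ∈ conjDom φ ∧ IsConjSubgradient φ (x n) (s n)) ∧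
    (Tendsto s atTop (𝓝 0) ∨ Tendsto s atTop atTop)

/-! ### Integrals -/

/-- The integral of an extended-real function, `∫ g⁺ dμ - ∫ g⁻ dμ`. -/
def eintegral {Y : Type*} [MeasurableSpace Y] (μ : Measure Y) (g : Y → EReal) : EReal :=
  ((∫⁻ y, (g y).toENNReal ∂μ : ℝ≥0∞) : EReal) - ((∫⁻ y, (-g y).toENNReal ∂μ : ℝ≥0∞) : EReal)

/-- The duality pairing `⟨δ, g⟩ = ∫ g dδ` of a signed measure and a function. -/
def pairing {Y : Type*} [MeasurableSpace Y] (δ : SignedMeasure Y) (g : Y → ℝ) : ℝ :=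
  VectorMeasure.integral δ g (ContinuousLinearMap.lsmul ℝ ℝ).flip

/-- A kernel `k` is positive if `⟨δ ⊗ δ, k⟩ = ⟨δ, k ⋆ δ⟩ ≥ 0` for every signed measure `δ`. -/
def IsPositiveKernel {Y : Type*} [MeasurableSpace Y] (k : Y → Y → ℝ) : Prop :=
  ∀ δ : SignedMeasure Y, 0 ≤ pairing δ (fun x => pairing δ (fun y => k x y))

/-- A finite measure as a signed measure. -/
def toSigned {Y : Type*} [MeasurableSpace Y] (α : FiniteMeasure Y) : SignedMeasure Y :=
  (α : Measure Y).toSignedMeasure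

/-! ### Differentiability on the cone of finite measures -/

section Gradient

variable {X : Type*} [TopologicalSpace X] [MeasurableSpace X]

/-- `p ∈ C(X)` is a gradient at `α` of the functional `G` on finite positive measures: `G α` is
finite, and for every signed measure `δ` one has `G (α + t δ) = G α + t ⟨δ, p⟩ + o(t)` as `t → 0`,
along those `t` (of either sign) for which `α + t δ` is a positive measure. -/
def HasMeasureGradient (G : FiniteMeasure X → EReal) (α : FiniteMeasure X) (p : C(X, ℝ)) : Prop :=
  G α ≠ ⊥ ∧ G α ≠ ⊤ ∧
    ∀ δ : SignedMeasure X, ∃ r : ℝ → ℝ, r =o[𝓝 0] (fun t : ℝ => t) ∧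
      ∀ᶠ t in 𝓝 (0 : ℝ), ∀ α' : FiniteMeasure X, toSigned α' = toSigned α + t • δ →
        G α' = G α + ((t * pairing δ p + r t : ℝ) : EReal)

theorem HasMeasureGradient.unique [BorelSpace X] [CompactSpace X] {G : FiniteMeasure X → EReal}
    {α : FiniteMeasure X} {p q : C(X, ℝ)} (hp : HasMeasureGradient G α p)
    (hq : HasMeasureGradient G α q) : p = q := by
  ext x
  obtain ⟨hb, ht, h1⟩ := hp
  obtain ⟨-, -, h2⟩ := hq
  obtain ⟨r, hr, hr'⟩ := h1 (toSigned ⟨Measure.dirac x, inferInstance⟩)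
  obtain ⟨u, hu, hu'⟩ := h2 (toSigned ⟨Measure.dirac x, inferInstance⟩)
  have hpair : ∀ f : C(X, ℝ), pairing (toSigned ⟨Measure.dirac x, inferInstance⟩) f = f x := by
    intro f
    unfold pairing toSigned
    have := VectorMeasure.integral_toSignedMeasure (μ := Measure.dirac x) (f := f)
    refine this.trans ?_
    exact integral_dirac' _ _ f.continuous.stronglyMeasurable
  rw [hpair] at hr' hu'
  have key : ∀ᶠ t in 𝓝[>] (0 : ℝ), t * (p x - q x) = u t - r t := by
    filter_upwards [hr'.filter_mono nhdsWithin_le_nhds, hu'.filter_mono nhdsWithin_le_nhds,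
      self_mem_nhdsWithin] with t ha hc h0
    lift t to ℝ≥0 using le_of_lt h0
    let d : FiniteMeasure X := ⟨Measure.dirac x, inferInstance⟩
    let α' : FiniteMeasure X := α + t • d
    have e : toSigned α' = toSigned α + (t : ℝ) • toSigned d :=
      (Measure.toSignedMeasure_add (α : Measure X) (t • (d : Measure X))).trans
        (congrArg (fun s => (α : Measure X).toSignedMeasure + s)
          (Measure.toSignedMeasure_smul (d : Measure X) t))
    have e2 := (ha α' e).symm.trans (hc α' e)
    lift G α to ℝ using ⟨ht, hb⟩ with g
    norm_cast at e2
    linarith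
  have hl : (fun t : ℝ => t * (p x - q x)) =o[𝓝[>] 0] (fun t : ℝ => t) :=
    ((hu.sub hr).mono nhdsWithin_le_nhds).congr' (key.mono fun t h => h.symm) (by rfl)
  have hl2 : Tendsto (fun t : ℝ => t * (p x - q x) / t) (𝓝[>] 0) (𝓝 0) := hl.tendsto_div_nhds_zero
  have hl3 : Tendsto (fun t : ℝ => t * (p x - q x) / t) (𝓝[>] 0) (𝓝 (p x - q x)) := by
    refine tendsto_const_nhds.congr' ?_
    filter_upwards [self_mem_nhdsWithin] with t h0
    have h0' : t ≠ 0 := ne_of_gt h0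
    field_simp
  exact sub_eq_zero.1 (tendsto_nhds_unique hl3 hl2)

/-- `G` is differentiable at `α`. -/
def MeasureDifferentiableAt (G : FiniteMeasure X → EReal) (α : FiniteMeasure X) : Prop :=
  ∃ p : C(X, ℝ), HasMeasureGradient G α p

open Classical in
/-- The (unique) gradient of `G` at `α`, when `G` is differentiable there; `0` otherwise. -/
def measureGradient (G : FiniteMeasure X → EReal) (α : FiniteMeasure X) : C(X, ℝ) :=
  if h : MeasureDifferentiableAt G α then h.choose else 0

/-- The symmetric Bregman divergence `⟨α - β, ∇G(α) - ∇G(β)⟩` of a functional `G`. -/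
def symmBregman (G : FiniteMeasure X → EReal) (α β : FiniteMeasure X) : ℝ :=
  pairing (toSigned α - toSigned β) (measureGradient G α - measureGradient G β)

end Gradient

/-! ### Entropic unbalanced optimal transport -/

section Transport

variable {X : Type*} [TopologicalSpace X] [MeasurableSpace X]

/-- The regularized unbalanced optimal transport cost: the infimum over positive measures `π` on
`X × X` of `∫ C dπ + D_φ(π₁|α) + D_φ(π₂|β) + ε KL(π|α ⊗ β)`. -/
def otCost (φ : ℝ≥0 → ℝ≥0∞) (C : X → X → ℝ) (ε : ℝ) (α β : FiniteMeasure X) : EReal :=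
  ⨅ π : FiniteMeasure (X × X),
    ((∫ z, C z.1 z.2 ∂(π : Measure (X × X)) : ℝ) : EReal) +
      ((csiszarDiv φ (π : Measure (X × X)).fst (α : Measure X) +
        csiszarDiv φ (π : Measure (X × X)).snd (β : Measure X) +
        ENNReal.ofReal ε * InformationTheory.klDiv (π : Measure (X × X))
          ((α : Measure X).prod (β : Measure X)) : ℝ≥0∞) : EReal)

/-- The unbalanced Sinkhorn divergence
`OT(α,β) - ½ OT(α,α) - ½ OT(β,β) + (ε/2) (m(α) - m(β))²`. -/
def sinkhornDiv (φ : ℝ≥0 → ℝ≥0∞) (C : X → X → ℝ) (ε : ℝ) (α β : FiniteMeasure X) : EReal :=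
  otCost φ C ε α β - ((1 / 2 : ℝ) : EReal) * otCost φ C ε α α
    - ((1 / 2 : ℝ) : EReal) * otCost φ C ε β β
    + ((ε / 2 * ((α.mass : ℝ) - (β.mass : ℝ)) ^ 2 : ℝ) : EReal)

/-- The unbalanced Sinkhorn entropy
`F(α) = - sup_{f ∈ C(X)} (⟨α, -φ^*(-f)⟩ - (ε/2) ⟨α ⊗ α, exp((f ⊕ f - C)/ε)⟩)`. -/
def sinkhornEntropy (φ : ℝ≥0 → ℝ≥0∞) (C : X → X → ℝ) (ε : ℝ) (α : FiniteMeasure X) : EReal :=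
  -⨆ f : C(X, ℝ), eintegral (α : Measure X) (fun x => -conj φ (-f x)) -
    ((ε / 2 * ∫ z, Real.exp ((f z.1 + f z.2 - C z.1 z.2) / ε)
      ∂((α : Measure X).prod (α : Measure X)) : ℝ) : EReal)

/-- The Hausdorff divergence: the symmetric Bregman divergence of the Sinkhorn entropy. -/
def hausdorffDiv (φ : ℝ≥0 → ℝ≥0∞) (C : X → X → ℝ) (ε : ℝ) (α β : FiniteMeasure X) : ℝ :=
  symmBregman (sinkhornEntropy φ C ε) α β

end Transport

end

end UnbalancedOT

open UnbalancedOT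

/-! Everything rests on a continuous symmetric potential `f` for each nonzero measure `α`. Let `s`
be the density with respect to `α` of the marginal of the plan `exp((f ⊕ f - C)/ε) α ⊗ α`. The
potential satisfies `-f x ∈ ∂φ(s x)`, equivalently `s x ∈ ∂φ^*(-f x)`. This is the optimality
condition of the dual problem. Put `P = φ^*(-f)`, and let `(g, u, Q)` be the corresponding data for
`β`.

Existence (`exists_potential`): the condition is a fixed point equation for a nonexpansive map of
the sup norm. Damping it gives contractions, whose fixed points are uniformly bounded and
equi-Lipschitz; Arzelà–Ascoli supplies a limit.

Gradient (`hasMeasureGradient`): `F` is an infimum of functionals quadratic in the measure, and the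
one attached to `f` is optimal at `α`, with derivative `P + ε s`. Strict convexity of `φ^*` makes
moving away from `f` cost at least linearly, uniformly in `x`. So near `α` the entropy differs from
the quadratic functional of `f` by `o(t)`, and the gradient is `P + ε s`.

Comparison (`half_hausdorffDiv_le_sinkhornDiv`): weak duality for `(α, β)` is tested with the pairs
`(f, f)` and `(g, g)` and averaged, while the plans built from `f` and `g` bound the two self-costs
from above. The mass terms cancel and exactly half the Hausdorff divergence is left. Finiteness of
the cost comes from plans of constant density, the only use of the extreme slopes.

Positivity (`hausdorffDiv_nonneg`): Fenchel–Young and `exp h ≥ 1 + h` give `H ≥ ε ⟨δ ⊗ δ,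
exp(-C/ε)⟩` with `δ = exp(f/ε) α - exp(g/ε) β`. -/

namespace UnbalancedOT

/-! ### Convex analysis of entropy functions -/

/-- `φ s` is finite and `q` is a subgradient of `φ` at `s`. -/
def SubgradientPair (φ : ℝ≥0 → ℝ≥0∞) (s : ℝ≥0) (q : ℝ) : Prop :=
  φ s ≠ ⊤ ∧ ∀ p : ℝ≥0, φ p ≠ ⊤ → (φ s).toReal + q * ((p : ℝ) - s) ≤ (φ p).toReal

theorem conj_le_coe_iff {φ : ℝ≥0 → ℝ≥0∞} {q c : ℝ} :
    conj φ q ≤ (c : EReal) ↔ ∀ p : ℝ≥0, φ p ≠ ⊤ → (p : ℝ) * q - (φ p).toReal ≤ c := by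
  unfold conj
  rw [iSup_le_iff]
  refine forall_congr' fun p => ?_
  by_cases hp : φ p = ⊤
  · simp [hp]
  · lift φ p to ℝ≥0 using hp with r
    simp only [ne_eq, ENNReal.coe_ne_top, not_false_eq_true, forall_const, ENNReal.coe_toReal]
    rw [show (((r : ℝ≥0∞)) : EReal) = ((r : ℝ) : EReal) from rfl, ← EReal.coe_sub,
      EReal.coe_le_coe_iff]

theorem coe_le_conj {φ : ℝ≥0 → ℝ≥0∞} (q : ℝ) {p : ℝ≥0} (hp : φ p ≠ ⊤) :
    (((p : ℝ) * q - (φ p).toReal : ℝ) : EReal) ≤ conj φ q := by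
  unfold conj
  refine le_trans (le_of_eq ?_) (le_iSup _ p)
  lift φ p to ℝ≥0 using hp with r
  rw [EReal.coe_sub]
  rfl

theorem SubgradientPair.conj_eq {φ : ℝ≥0 → ℝ≥0∞} {s : ℝ≥0} {q : ℝ} (h : SubgradientPair φ s q) :
    conj φ q = (((s : ℝ) * q - (φ s).toReal : ℝ) : EReal) := by
  refine le_antisymm (conj_le_coe_iff.2 fun p hp => ?_) (coe_le_conj q h.1)
  have := h.2 p hp
  linarith

theorem SubgradientPair.mono {φ : ℝ≥0 → ℝ≥0∞} {s₁ s₂ : ℝ≥0} {q₁ q₂ : ℝ}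
    (h₁ : SubgradientPair φ s₁ q₁) (h₂ : SubgradientPair φ s₂ q₂) :
    0 ≤ ((s₁ : ℝ) - s₂) * (q₁ - q₂) := by
  have := h₁.2 _ h₂.1
  have := h₂.2 _ h₁.1
  linarith

theorem IsEntropyFunction.subgradientPair_one {φ : ℝ≥0 → ℝ≥0∞} (hφ : IsEntropyFunction φ) :
    SubgradientPair φ 1 0 :=
  ⟨by simp [hφ.map_one], fun p _ => by simp [hφ.map_one]⟩

theorem IsEntropyFunction.toReal_convex {φ : ℝ≥0 → ℝ≥0∞} (hφ : IsEntropyFunction φ)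
    {x y a b : ℝ≥0} (hab : a + b = 1) (hx : φ x ≠ ⊤) (hy : φ y ≠ ⊤) :
    φ (a * x + b * y) ≠ ⊤ ∧
      (φ (a * x + b * y)).toReal ≤ a * (φ x).toReal + b * (φ y).toReal := by
  have h := hφ.convexOn.2 (mem_univ x) (mem_univ y) (zero_le) (zero_le) hab
  simp only [smul_eq_mul, ENNReal.smul_def] at h
  have hfin : (a : ℝ≥0∞) * φ x + b * φ y ≠ ⊤ :=
    ENNReal.add_ne_top.2 ⟨ENNReal.mul_ne_top ENNReal.coe_ne_top hx,
      ENNReal.mul_ne_top ENNReal.coe_ne_top hy⟩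
  refine ⟨ne_top_of_le_ne_top hfin h, ?_⟩
  have := ENNReal.toReal_mono hfin h
  rw [ENNReal.toReal_add (ENNReal.mul_ne_top ENNReal.coe_ne_top hx)
      (ENNReal.mul_ne_top ENNReal.coe_ne_top hy), ENNReal.toReal_mul, ENNReal.toReal_mul] at this
  simpa using this

theorem IsEntropyFunction.ne_top_of_mem_Icc {φ : ℝ≥0 → ℝ≥0∞} (hφ : IsEntropyFunction φ)
    {x y z : ℝ≥0} (hx : φ x ≠ ⊤) (hy : φ y ≠ ⊤) (hz : z ∈ Icc x y) : φ z ≠ ⊤ := by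
  rcases (hz.1.trans hz.2).eq_or_lt with rfl | hxy
  · rwa [le_antisymm hz.2 hz.1]
  have hd : y - x ≠ 0 := (tsub_pos_of_lt hxy).ne'
  have hab : (y - z) / (y - x) + (z - x) / (y - x) = 1 := by
    rw [← add_div, tsub_add_tsub_cancel hz.2 hz.1, div_self hd]
  have h := (hφ.toReal_convex hab hx hy).1
  convert h
  have h1 : (0 : ℝ) < y - x := sub_pos.2 hxy
  apply NNReal.eq
  push_cast [NNReal.coe_sub hz.2, NNReal.coe_sub hz.1, NNReal.coe_sub hxy.le]
  field_simp
  ring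

/-- Tangent line inequality at `u`, where the derivative is `log u`. The point `s = 0` is allowed,
which matters when positivity of a minimizer is not yet known. -/
theorem klFun_sub_le {u s : ℝ} (hu : 0 < u) (hs : 0 ≤ s) :
    InformationTheory.klFun u - InformationTheory.klFun s ≤ Real.log u * (u - s) := by
  simp only [InformationTheory.klFun_apply]
  rcases hs.eq_or_lt with rfl | hs
  · simp only [zero_mul, sub_zero]; nlinarith
  · have h := Real.log_le_sub_one_of_pos (div_pos hu hs)
    rw [Real.log_div hu.ne' hs.ne'] at h
    have h2 : s * (Real.log u - Real.log s) ≤ s * (u / s - 1) := mul_le_mul_of_nonneg_left h hs.le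
    have h3 : s * (u / s - 1) = u - s := by field_simp
    linarith

/-- Perturbing an entropy function by a multiple of the Kullback–Leibler function gives a
function with a positive minimizer. -/
theorem IsEntropyFunction.exists_subgradientPair_log {φ : ℝ≥0 → ℝ≥0∞} (hφ : IsEntropyFunction φ)
    {ε : ℝ} (hε : 0 < ε) {lam : ℝ≥0} (hlam : 0 < lam) :
    ∃ s : ℝ≥0, 0 < s ∧ SubgradientPair φ s (-(ε * Real.log ((s : ℝ) / lam))) := by
  have hlam' : (0 : ℝ) < lam := hlam
  -- The derivative of `k` at `s` is `ε log (s / lam)`, so the optimality condition for a minimizer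
  -- of `φ + k` is the required subgradient relation.
  set k : ℝ≥0 → ℝ := fun s => ε * lam * InformationTheory.klFun ((s : ℝ) / lam) with hk
  have hk0 : ∀ s, 0 ≤ k s := fun s =>
    mul_nonneg (by positivity) (InformationTheory.klFun_nonneg (by positivity))
  have hkc : Continuous k := by
    have := InformationTheory.continuous_klFun
    fun_prop
  set G : ℝ≥0 → ℝ≥0∞ := fun s => φ s + ENNReal.ofReal (k s) with hG
  have hGl : LowerSemicontinuous G :=
    hφ.lowerSemicontinuous.add (ENNReal.continuous_ofReal.comp hkc).lowerSemicontinuous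
  have hklim : Tendsto k atTop atTop := by
    refine Tendsto.const_mul_atTop (by positivity) (InformationTheory.tendsto_klFun_atTop.comp ?_)
    exact Tendsto.atTop_div_const hlam' (NNReal.tendsto_coe_atTop.2 tendsto_id)
  obtain ⟨R, hR⟩ := (hklim.eventually_gt_atTop (k 1)).exists_forall_of_atTop
  obtain ⟨s, -, hs⟩ := LowerSemicontinuousOn.exists_isMinOn (s := Icc 0 (max R 1))
    ⟨1, zero_le, le_max_right _ _⟩ isCompact_Icc (hGl.lowerSemicontinuousOn _)
  have hG1 : G 1 = ENNReal.ofReal (k 1) := by simp [hG, hφ.map_one]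
  have hmin : ∀ p, G s ≤ G p := by
    intro p
    by_cases hp : p ≤ max R 1
    · exact hs ⟨zero_le, hp⟩
    · refine (hs (show (1 : ℝ≥0) ∈ _ from ⟨zero_le, le_max_right _ _⟩)).trans ?_
      have : k 1 < k p := hR p ((le_max_left _ _).trans (not_le.1 hp).le)
      exact hG1.le.trans ((ENNReal.ofReal_le_ofReal this.le).trans le_add_self)
  have hsfin : φ s ≠ ⊤ := by
    refine ne_top_of_le_ne_top (b := G 1) (by simp [hG1]) ?_
    exact le_self_add.trans (hmin 1)
  have hreal : ∀ p, φ p ≠ ⊤ → (φ s).toReal + k s ≤ (φ p).toReal + k p := by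
    intro p hp
    have := ENNReal.toReal_mono (by simp [hG, hp]) (hmin p)
    simp only [hG] at this
    rwa [ENNReal.toReal_add hsfin (by simp), ENNReal.toReal_add hp (by simp),
      ENNReal.toReal_ofReal (hk0 _), ENNReal.toReal_ofReal (hk0 _)] at this
  -- First-order condition along the segment from `s` to `p`. The tangent to `k` is taken at the
  -- moving point, so that `s = 0` is not excluded.
  have key : ∀ p, φ p ≠ ⊤ → ∀ θ : ℝ≥0, 0 < θ → θ < 1 → 0 < (1 - θ) * s + θ * p →
      -(ε * Real.log (((1 - θ : ℝ) * s + θ * p) / lam)) * ((p : ℝ) - s)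
        ≤ (φ p).toReal - (φ s).toReal := by
    intro p hp θ h0 h1 hu
    obtain ⟨hf, hc⟩ := hφ.toReal_convex (a := 1 - θ) (b := θ) (tsub_add_cancel_of_le h1.le) hsfin hp
    have h2 := hreal _ hf
    have hcoe : (((1 - θ) * s + θ * p : ℝ≥0) : ℝ) = (1 - θ : ℝ) * s + θ * p := by
      push_cast [NNReal.coe_sub h1.le]; rfl
    have hu' : (0 : ℝ) < (1 - θ : ℝ) * s + θ * p := by rw [← hcoe]; exact hu
    have h3 := klFun_sub_le (div_pos hu' hlam') (s := s / lam) (by positivity)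
    simp only [hk, hcoe] at h2
    rw [NNReal.coe_sub h1.le] at hc
    push_cast at hc
    have h4 := mul_le_mul_of_nonneg_left h3 (show 0 ≤ ε * (lam : ℝ) by positivity)
    have h5 : ε * lam * (Real.log (((1 - θ : ℝ) * s + θ * p) / lam) *
        (((1 - θ : ℝ) * s + θ * p) / lam - s / lam)) =
        θ * ((ε * Real.log (((1 - θ : ℝ) * s + θ * p) / lam)) * ((p : ℝ) - s)) := by
      field_simp; ring
    rw [h5] at h4
    have h0' : (0 : ℝ) < θ := h0
    refine le_of_mul_le_mul_left ?_ h0'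
    linarith
  -- At `s = 0` the slope of `k` is `-∞`, while moving towards `1`, where `φ` vanishes, does not
  -- raise `φ`: this contradicts minimality.
  have hspos : 0 < s := by
    by_contra hs0
    obtain rfl : s = 0 := by simpa using hs0
    have hlog : Tendsto (fun θ : ℝ≥0 => -(ε * Real.log ((θ : ℝ) / lam))) (𝓝[>] 0) atTop := by
      refine tendsto_neg_atBot_atTop.comp (Tendsto.const_mul_atBot hε ?_)
      refine Real.tendsto_log_nhdsGT_zero.comp ?_
      refine tendsto_nhdsWithin_iff.2 ⟨?_, ?_⟩
      · refine tendsto_nhdsWithin_of_tendsto_nhds ?_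
        have : Continuous fun θ : ℝ≥0 => (θ : ℝ) / lam := by fun_prop
        simpa using this.tendsto 0
      · filter_upwards [self_mem_nhdsWithin] with θ hθ
        exact div_pos hθ hlam'
    have hlt : ∀ᶠ θ : ℝ≥0 in 𝓝[>] 0, θ < 1 := nhdsWithin_le_nhds (eventually_lt_nhds one_pos)
    have : (𝓝[>] (0 : ℝ≥0)).NeBot := inferInstance
    obtain ⟨θ, hθ, hθ1, hθ0⟩ := ((hlog.eventually_gt_atTop 0).and
      (hlt.and self_mem_nhdsWithin)).exists
    have hθ0' : (0 : ℝ≥0) < θ := hθ0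
    have := key 1 (by simp [hφ.map_one]) θ hθ0 hθ1 (by simpa using hθ0')
    simp [hφ.map_one] at this
    have h3 : 0 ≤ (φ 0).toReal := ENNReal.toReal_nonneg
    linarith
  refine ⟨s, hspos, hsfin, fun p hp => ?_⟩
  have hspos' : (0 : ℝ) < s := hspos
  have hlim : Tendsto (fun θ : ℝ≥0 =>
      -(ε * Real.log (((1 - θ : ℝ) * s + θ * p) / lam)) * ((p : ℝ) - s)) (𝓝[>] 0)
      (𝓝 (-(ε * Real.log ((s : ℝ) / lam)) * ((p : ℝ) - s))) := by
    refine tendsto_nhdsWithin_of_tendsto_nhds ?_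
    have hc : ContinuousAt (fun θ : ℝ≥0 =>
      -(ε * Real.log (((1 - θ : ℝ) * s + θ * p) / lam)) * ((p : ℝ) - s)) 0 := by
      have : ContinuousAt (fun θ : ℝ≥0 => Real.log (((1 - θ : ℝ) * s + θ * p) / lam)) 0 := by
        refine ContinuousAt.log (by fun_prop) ?_
        simp only [NNReal.coe_zero, sub_zero, one_mul, zero_mul, add_zero]
        positivity
      fun_prop
    simpa [ContinuousAt] using hc
  have hlt : ∀ᶠ θ : ℝ≥0 in 𝓝[>] 0, θ < 1 := nhdsWithin_le_nhds (eventually_lt_nhds one_pos)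
  have := le_of_tendsto hlim (b := (φ p).toReal - (φ s).toReal) (by
    filter_upwards [hlt, self_mem_nhdsWithin] with θ h1 h0
    have h0' : (0 : ℝ≥0) < θ := h0
    exact key p hp θ h0 h1 (add_pos_of_pos_of_nonneg (mul_pos (tsub_pos_of_lt h1) hspos)
      zero_le))
  linarith

/-- The pointwise form of the optimality condition: `l` stands for the log-sum-exp of the other
potential and `t` for the new potential value. It is the positive minimizer rewritten in logarithmic
coordinates. -/
theorem IsEntropyFunction.exists_prox {φ : ℝ≥0 → ℝ≥0∞} (hφ : IsEntropyFunction φ)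
    {ε : ℝ} (hε : 0 < ε) (l : ℝ) :
    ∃ t : ℝ, SubgradientPair φ (Real.exp ((t + l) / ε)).toNNReal (-t) := by
  obtain ⟨s, hs, h⟩ := hφ.exists_subgradientPair_log hε
    (lam := (Real.exp (l / ε)).toNNReal) (by simpa using Real.exp_pos _)
  have hs' : (0 : ℝ) < s := hs
  rw [Real.coe_toNNReal _ (Real.exp_pos _).le] at h
  refine ⟨ε * Real.log ((s : ℝ) / Real.exp (l / ε)), ?_⟩
  convert h
  rw [Real.log_div hs'.ne' (Real.exp_pos _).ne', Real.log_exp]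
  have : (ε * (Real.log s - l / ε) + l) / ε = Real.log s := by field_simp; ring
  rw [this, Real.exp_log hs', Real.toNNReal_coe]

/-- Subgradients of `φ` are monotone: when `t` increases, `-t` decreases, so `t + l` cannot
increase. Hence the solution is a decreasing 1-Lipschitz function of `l`. -/
theorem SubgradientPair.prox_sub_le {φ : ℝ≥0 → ℝ≥0∞} {ε : ℝ} (hε : 0 < ε) {l₁ l₂ t₁ t₂ : ℝ}
    (h₁ : SubgradientPair φ (Real.exp ((t₁ + l₁) / ε)).toNNReal (-t₁))
    (h₂ : SubgradientPair φ (Real.exp ((t₂ + l₂) / ε)).toNNReal (-t₂)) (ht : t₁ < t₂) :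
    t₂ - t₁ ≤ l₁ - l₂ := by
  have h := h₁.mono h₂
  rw [Real.coe_toNNReal _ (Real.exp_pos _).le, Real.coe_toNNReal _ (Real.exp_pos _).le] at h
  have h2 : 0 ≤ Real.exp ((t₁ + l₁) / ε) - Real.exp ((t₂ + l₂) / ε) :=
    nonneg_of_mul_nonneg_left h (by linarith)
  have h3 := Real.exp_le_exp.1 (sub_nonneg.1 h2)
  rw [div_le_div_iff_of_pos_right hε] at h3
  linarith

/-- Equality would put both ends of the segment from `q` to `q + h` on one affine minorant of `φ^*`;
strict convexity at the midpoint would then push `φ^*` below it. -/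
theorem ConjStrictlyConvex.lt_conj {φ : ℝ≥0 → ℝ≥0∞} (hφ : ConjStrictlyConvex φ) {s : ℝ≥0}
    {q h : ℝ} (hs : SubgradientPair φ s q) (hh : h ≠ 0) :
    (((s : ℝ) * (q + h) - (φ s).toReal : ℝ) : EReal) < conj φ (q + h) := by
  refine lt_of_le_of_ne (coe_le_conj _ hs.1) fun heq => ?_
  have hq := hs.conj_eq
  have h1 : q ∈ conjDom φ := by simp only [conjDom, mem_ofPred_eq, hq]; exact EReal.coe_ne_top _
  have h2 : q + h ∈ conjDom φ := by
    simp only [conjDom, mem_ofPred_eq, ← heq]; exact EReal.coe_ne_top _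
  obtain ⟨hcv, hsc⟩ := hφ
  have hlt := hsc h1 h2 (by simpa using hh) (a := 1 / 2) (b := 1 / 2) (by norm_num)
    (by norm_num) (by norm_num)
  have hmem := hcv h1 h2 (a := 1 / 2) (b := 1 / 2) (by norm_num) (by norm_num) (by norm_num)
  simp only [smul_eq_mul] at hlt hmem
  have h3 := coe_le_conj (1 / 2 * q + 1 / 2 * (q + h)) hs.1
  rw [hq, ← heq, EReal.toReal_coe, EReal.toReal_coe] at hlt
  have h4 := EReal.toReal_le_toReal h3 (EReal.coe_ne_bot _) hmem
  rw [EReal.toReal_coe] at h4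
  linarith

theorem ConjStrictlyConvex.exists_lt {φ : ℝ≥0 → ℝ≥0∞} (hφ : ConjStrictlyConvex φ) {s : ℝ≥0}
    {q h : ℝ} (hs : SubgradientPair φ s q) (hh : h ≠ 0) :
    ∃ p : ℝ≥0, φ p ≠ ⊤ ∧ (s : ℝ) * (q + h) - (φ s).toReal < (p : ℝ) * (q + h) - (φ p).toReal := by
  by_contra! H
  exact (hφ.lt_conj hs hh).not_ge (conj_le_coe_iff.2 H)

/-- Extreme slopes of the conjugate force the domain of `φ` to reach `0` or `+∞`. -/
theorem ConjExtremeSlopes.exists_scaling {φ : ℝ≥0 → ℝ≥0∞} (hφ : IsEntropyFunction φ)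
    (h : ConjExtremeSlopes φ) {a b : ℝ≥0} (ha : 0 < a) (hb : 0 < b) :
    ∃ c : ℝ≥0, φ (c * a) ≠ ⊤ ∧ φ (c * b) ≠ ⊤ := by
  wlog hab : a ≤ b generalizing a b
  · obtain ⟨c, h1, h2⟩ := this hb ha (not_le.1 hab).le
    exact ⟨c, h2, h1⟩
  have h1fin : φ 1 ≠ ⊤ := by simp [hφ.map_one]
  obtain ⟨x, s, hxs, hlim | hlim⟩ := h
  · have hr : 0 < a / b := div_pos ha hb
    obtain ⟨n, hn⟩ := (hlim.eventually_lt_const (show (0 : ℝ) < ((a / b : ℝ≥0) : ℝ) from hr)).exists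
    -- If `φ` were infinite on `[0, a / b]`, lowering the argument by `1` would lower `φ^*` by at
    -- least `a / b`, more than the slope `s n` allows.
    obtain ⟨p, hp, hpfin⟩ : ∃ p : ℝ≥0, p ≤ a / b ∧ φ p ≠ ⊤ := by
      by_contra! H
      obtain ⟨hx, hsub⟩ := hxs n
      have hbot : conj φ (x n) ≠ ⊥ := fun hb => by
        have := coe_le_conj (x n) h1fin
        rw [hb] at this
        exact EReal.coe_ne_bot _ (le_bot_iff.1 this)
      have h1 := hsub (x n - 1)
      have hx' : conj φ (x n) ≠ ⊤ := hx
      lift conj φ (x n) to ℝ using ⟨hx', hbot⟩ with v hv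
      have h2 : conj φ (x n - 1) ≤ ((v - (a / b : ℝ≥0) : ℝ) : EReal) := by
        refine conj_le_coe_iff.2 fun p hp => ?_
        have h3 := coe_le_conj (x n) hp
        rw [← hv, EReal.coe_le_coe_iff] at h3
        have h4 : (a / b : ℝ≥0) < p := by
          by_contra h5
          exact hp (H p (not_lt.1 h5))
        have h4' : ((a / b : ℝ≥0) : ℝ) < p := h4
        linarith
      have h5 := h1.trans h2
      norm_cast at h5
      push_cast at h5
      push_cast at hn
      linarith
    have hb' : b⁻¹ * b = 1 := inv_mul_cancel₀ hb.ne'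
    refine ⟨b⁻¹, ?_, ?_⟩
    · refine hφ.ne_top_of_mem_Icc hpfin h1fin ⟨?_, ?_⟩
      · rwa [mul_comm, ← div_eq_mul_inv]
      · rw [← hb']; gcongr
    · rwa [hb']
  · obtain ⟨n, hn⟩ := (hlim.eventually_gt_atTop ((b / a : ℝ≥0) : ℝ)).exists
    -- Mirror argument: with a domain bounded by `b / a`, raising the argument by `1` could not
    -- raise `φ^*` as fast as the slope `s n` demands.
    obtain ⟨p, hp, hpfin⟩ : ∃ p : ℝ≥0, b / a ≤ p ∧ φ p ≠ ⊤ := by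
      by_contra! H
      obtain ⟨hx, hsub⟩ := hxs n
      have hbot : conj φ (x n) ≠ ⊥ := fun hb => by
        have := coe_le_conj (x n) h1fin
        rw [hb] at this
        exact EReal.coe_ne_bot _ (le_bot_iff.1 this)
      have h1 := hsub (x n + 1)
      have hx' : conj φ (x n) ≠ ⊤ := hx
      lift conj φ (x n) to ℝ using ⟨hx', hbot⟩ with v hv
      have h2 : conj φ (x n + 1) ≤ ((v + (b / a : ℝ≥0) : ℝ) : EReal) := by
        refine conj_le_coe_iff.2 fun p hp => ?_
        have h3 := coe_le_conj (x n) hp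
        rw [← hv, EReal.coe_le_coe_iff] at h3
        have h4 : p < (b / a : ℝ≥0) := by
          by_contra h5
          exact hp (H p (not_lt.1 h5))
        have h4' : (p : ℝ) < ((b / a : ℝ≥0) : ℝ) := h4
        linarith
      have h5 := h1.trans h2
      norm_cast at h5
      push_cast at h5
      push_cast at hn
      linarith
    have ha' : a⁻¹ * a = 1 := inv_mul_cancel₀ ha.ne'
    refine ⟨a⁻¹, ?_, ?_⟩
    · rwa [ha']
    · refine hφ.ne_top_of_mem_Icc h1fin hpfin ⟨?_, ?_⟩
      · rw [← ha']; gcongr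
      · rwa [mul_comm, ← div_eq_mul_inv]

/-! ### Existence of symmetric optimal potentials -/

theorem integrable_of_continuous {Y : Type*} [TopologicalSpace Y] [CompactSpace Y]
    [MeasurableSpace Y] [BorelSpace Y] (μ : Measure Y) [IsFiniteMeasure μ] {g : Y → ℝ}
    (hg : Continuous g) : Integrable g μ :=
  hg.integrable_of_hasCompactSupport (HasCompactSupport.of_compactSpace g)

/-- The scaled log-sum-exp functional `ε log ∫ exp(a / ε) dα`. -/
noncomputable def logIntExp {X : Type*} [MeasurableSpace X] (α : Measure X) (ε : ℝ) (a : X → ℝ) :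
    ℝ :=
  ε * Real.log (∫ y, Real.exp (a y / ε) ∂α)

/-- The density `x ↦ ∫ exp((f x + f y - C x y) / ε) dα(y)` with respect to `α` of the marginal of
the plan `exp((f ⊕ f - C) / ε) α ⊗ α`. -/
noncomputable def marginalDensity {X : Type*} [MeasurableSpace X] (C : X → X → ℝ) (ε : ℝ)
    (α : Measure X) (f : X → ℝ) (x : X) : ℝ :=
  ∫ y, Real.exp ((f x + f y - C x y) / ε) ∂α

section

variable {X : Type*} [MetricSpace X] [CompactSpace X] [MeasurableSpace X] [BorelSpace X]
  {α : Measure X} [IsFiniteMeasure α] {ε : ℝ}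

theorem integral_exp_pos_of_continuous [NeZero α] {a : X → ℝ} (ha : Continuous a) :
    0 < ∫ y, Real.exp (a y) ∂α :=
  integral_exp_pos (integrable_of_continuous α (by fun_prop))

/-- Monotonicity together with commutation with constants; this makes the functional nonexpansive in
the sup norm. -/
theorem logIntExp_le [NeZero α] (hε : 0 < ε) {a b : X → ℝ} (ha : Continuous a)
    (hb : Continuous b) {c : ℝ} (h : ∀ y, a y ≤ b y + c) :
    logIntExp α ε a ≤ logIntExp α ε b + c := by
  have h1 : ∫ y, Real.exp (a y / ε) ∂α ≤ Real.exp (c / ε) * ∫ y, Real.exp (b y / ε) ∂α := by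
    rw [← integral_const_mul]
    refine integral_mono (integrable_of_continuous α (by fun_prop))
      (integrable_of_continuous α (by fun_prop)) fun y => ?_
    simp only
    rw [← Real.exp_add, ← add_div]
    refine Real.exp_le_exp.2 (div_le_div_of_nonneg_right ?_ hε.le)
    linarith [h y]
  have h2 := Real.log_le_log (integral_exp_pos_of_continuous (by fun_prop)) h1
  rw [Real.log_mul (Real.exp_pos _).ne' (integral_exp_pos_of_continuous (by fun_prop)).ne',
    Real.log_exp] at h2
  have h3 := mul_le_mul_of_nonneg_left h2 hε.le
  have h4 : ε * (c / ε) = c := by field_simp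
  unfold logIntExp
  linarith

theorem abs_logIntExp_sub_le [NeZero α] (hε : 0 < ε) {a b : X → ℝ} (ha : Continuous a)
    (hb : Continuous b) {c : ℝ} (h : ∀ y, |a y - b y| ≤ c) :
    |logIntExp α ε a - logIntExp α ε b| ≤ c := by
  have h1 := logIntExp_le (α := α) hε ha hb (c := c) fun y => by linarith [(abs_le.1 (h y)).2]
  have h2 := logIntExp_le (α := α) hε hb ha (c := c) fun y => by linarith [(abs_le.1 (h y)).1]
  exact abs_le.2 ⟨by linarith, by linarith⟩

theorem exp_logIntExp [NeZero α] (hε : 0 < ε) {a : X → ℝ} (ha : Continuous a) (t : ℝ) :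
    Real.exp ((t + logIntExp α ε a) / ε) = ∫ y, Real.exp ((t + a y) / ε) ∂α := by
  have : (t + logIntExp α ε a) / ε = t / ε + Real.log (∫ y, Real.exp (a y / ε) ∂α) := by
    unfold logIntExp; field_simp
  rw [this, Real.exp_add, Real.exp_log (integral_exp_pos_of_continuous (by fun_prop)),
    ← integral_const_mul]
  simp_rw [← Real.exp_add, ← add_div]

/-- The map sending `g` to `τ` of the log-sum-exp of `g - C x` is nonexpansive, and its values are
`γ`-Lipschitz because `C` is. A fixed point is obtained by damping and compactness. -/
theorem exists_potential [NeZero α] {φ : ℝ≥0 → ℝ≥0∞} (hφ : IsEntropyFunction φ) (hε : 0 < ε)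
    {C : X → X → ℝ} (hC_cont : Continuous (fun z : X × X => C z.1 z.2))
    (hC_diag : ∀ x, C x x = 0) {γ : ℝ≥0} (hC_lip : ∀ x y z, |C x z - C y z| ≤ γ * dist x y) :
    ∃ f : C(X, ℝ), ∀ x, SubgradientPair φ (marginalDensity C ε α f x).toNNReal (-f x) := by
  choose τ hτ using hφ.exists_prox hε
  have hCx : ∀ x, Continuous (C x) := fun x =>
    hC_cont.comp (Continuous.prodMk_right x)
  have hτlip : ∀ l₁ l₂, |τ l₁ - τ l₂| ≤ |l₁ - l₂| := by
    have key : ∀ l₁ l₂, τ l₁ ≤ τ l₂ → |τ l₁ - τ l₂| ≤ |l₁ - l₂| := by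
      intro l₁ l₂ h
      rcases h.eq_or_lt with h | h
      · simp [h]
      · have := (hτ l₁).prox_sub_le hε (hτ l₂) h
        rw [abs_sub_comm, abs_of_pos (by linarith)]
        exact this.trans (le_abs_self _)
    intro l₁ l₂
    rcases le_total (τ l₁) (τ l₂) with h | h
    · exact key _ _ h
    · rw [abs_sub_comm, abs_sub_comm l₁]; exact key _ _ h
  -- Since `φ` is minimal at `1`, the value `t = 0` solves the equation at `l = 0`. Comparison with
  -- it bounds `τ l` by `-l` or `l` according to its sign.
  have h00 : SubgradientPair φ (Real.exp (((0 : ℝ) + 0) / ε)).toNNReal (-0) := by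
    simpa using hφ.subgradientPair_one
  have hτpos : ∀ l, 0 < τ l → τ l ≤ -l := fun l h => by
    linarith [h00.prox_sub_le hε (hτ l) h]
  have hτneg : ∀ l, τ l < 0 → -τ l ≤ l := fun l h => by
    linarith [(hτ l).prox_sub_le hε h00 h]
  set κ : ℝ := γ * Metric.diam (univ : Set X) with hκ
  have hdist : ∀ x y : X, γ * dist x y ≤ κ := fun x y =>
    mul_le_mul_of_nonneg_left (Metric.dist_le_diam_of_mem isCompact_univ.isBounded (mem_univ x)
      (mem_univ y)) γ.2
  have hCκ : ∀ x y, |C x y| ≤ κ := fun x y => by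
    have := hC_lip x y y
    rw [hC_diag, sub_zero] at this
    exact this.trans (hdist x y)
  let l : (X → ℝ) → X → ℝ := fun g x => logIntExp α ε (fun y => g y - C x y)
  have hlx : ∀ g : X → ℝ, Continuous g → ∀ x x', |l g x - l g x'| ≤ γ * dist x x' := by
    intro g hg x x'
    refine abs_logIntExp_sub_le hε (hg.sub (hCx x)) (hg.sub (hCx x')) fun y => ?_
    have := hC_lip x x' y
    rw [abs_sub_comm] at this
    simpa only [Pi.sub_apply, sub_sub_sub_cancel_left] using this
  have hTx : ∀ g : X → ℝ, Continuous g → ∀ x x', |τ (l g x) - τ (l g x')| ≤ γ * dist x x' :=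
    fun g hg x x' => (hτlip _ _).trans (hlx g hg x x')
  have hTc : ∀ g : X → ℝ, Continuous g → Continuous fun x => τ (l g x) := fun g hg =>
    (LipschitzWith.of_dist_le_mul (K := γ) fun x y => by
      rw [Real.dist_eq]; exact hTx g hg x y).continuous
  let T : BoundedContinuousFunction X ℝ → BoundedContinuousFunction X ℝ := fun g =>
    BoundedContinuousFunction.mkOfCompact ⟨_, hTc g g.continuous⟩
  have hTdef : ∀ g x, T g x = τ (l g x) := fun g x => rfl
  have hT : ∀ g g', dist (T g) (T g') ≤ dist g g' := by
    intro g g'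
    refine (BoundedContinuousFunction.dist_le dist_nonneg).2 fun x => ?_
    rw [hTdef, hTdef, Real.dist_eq]
    refine (hτlip _ _).trans (abs_logIntExp_sub_le hε (g.continuous.sub (hCx x))
      (g'.continuous.sub (hCx x)) fun y => ?_)
    have := BoundedContinuousFunction.dist_coe_le_dist (f := g) (g := g') y
    simpa only [Pi.sub_apply, Real.dist_eq, sub_sub_sub_cancel_right] using this
  have hTL : LipschitzWith 1 T := LipschitzWith.of_dist_le_mul (by simpa using hT)
  -- Damping factors below `1` and tending to `1`: each damped map is a contraction.
  let r : ℕ → ℝ≥0 := fun n => n / (n + 1)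
  have hr1 : ∀ n, r n < 1 := fun n => by
    rw [div_lt_one (by positivity)]; exact lt_add_one _
  have hrlim : Tendsto (fun n => (r n : ℝ)) atTop (𝓝 1) := by
    simpa [r] using tendsto_natCast_div_add_atTop (1 : ℝ)
  have hcontr : ∀ n, ContractingWith (r n) (fun g => T ((r n : ℝ) • g)) := fun n => by
    refine ⟨hr1 n, ?_⟩
    refine LipschitzWith.of_dist_le_mul fun g g' => (hT _ _).trans ?_
    have hr0 : (0 : ℝ) ≤ r n := NNReal.coe_nonneg _
    refine (BoundedContinuousFunction.dist_le (mul_nonneg hr0 dist_nonneg)).2 fun x => ?_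
    change dist ((r n : ℝ) * g x) ((r n : ℝ) * g' x) ≤ _
    rw [Real.dist_eq, ← mul_sub, abs_mul, abs_of_nonneg hr0, ← Real.dist_eq]
    exact mul_le_mul_of_nonneg_left (BoundedContinuousFunction.dist_coe_le_dist x) hr0
  have hexists : ∀ n, ∃ f, T ((r n : ℝ) • f) = f := fun n =>
    ⟨_, (hcontr n).fixedPoint_isFixedPt⟩
  choose f hf using hexists
  have hfx : ∀ n x, τ (l (fun y => r n * f n y) x) = f n x := fun n x =>
    congrArg (fun g : BoundedContinuousFunction X ℝ => g x) (hf n)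
  have hflip : ∀ n x y, |f n x - f n y| ≤ γ * dist x y := fun n x y => by
    rw [← hfx n x, ← hfx n y]
    exact hTx _ (continuous_const.mul (f n).continuous) x y
  -- One `κ` pays for the oscillation of the damped potential, the other for the size of `C`; the
  -- bound does not depend on `n`.
  set M : ℝ := |logIntExp α ε 0| + 2 * κ with hM
  have hbound : ∀ n x, |f n x| ≤ M := by
    intro n x
    have hκ0 : 0 ≤ κ := (abs_nonneg _).trans (hCκ x x)
    have hr0 : (0 : ℝ) ≤ r n := (r n).2
    have hr1' : (r n : ℝ) ≤ 1 := (hr1 n).le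
    have hcont : Continuous fun y => r n * f n y - C x y :=
      (continuous_const.mul (f n).continuous).sub (hCx x)
    have hosc : ∀ y, |r n * f n y - r n * f n x| ≤ κ := fun y => by
      rw [← mul_sub, abs_mul, abs_of_nonneg hr0]
      have := (hflip n y x).trans (hdist y x)
      nlinarith [abs_nonneg (f n y - f n x)]
    have h1 := hfx n x
    rcases lt_trichotomy (f n x) 0 with h | h | h
    · rw [abs_of_neg h]
      have h2 := hτneg _ (h1.trans_lt h)
      rw [h1] at h2
      have h3 : l (fun y => r n * f n y) x ≤ logIntExp α ε 0 + 2 * κ := by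
        refine logIntExp_le hε hcont continuous_zero fun y => ?_
        simp only [Pi.zero_apply]
        nlinarith [(abs_le.1 (hosc y)).2, (abs_le.1 (hCκ x y)).1]
      linarith [le_abs_self (logIntExp α ε 0)]
    · rw [h, abs_zero]; positivity
    · rw [abs_of_pos h]
      have h2 := hτpos _ (h.trans_eq h1.symm)
      rw [h1] at h2
      have h3 : logIntExp α ε 0 ≤ l (fun y => r n * f n y) x + 2 * κ := by
        refine logIntExp_le hε continuous_zero hcont fun y => ?_
        simp only [Pi.zero_apply]
        nlinarith [(abs_le.1 (hosc y)).1, (abs_le.1 (hCκ x y)).2]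
      linarith [neg_abs_le (logIntExp α ε 0)]
  have hcomp := BoundedContinuousFunction.arzela_ascoli (Icc (-M) M) isCompact_Icc (range f)
    (by rintro _ x ⟨n, rfl⟩; exact abs_le.1 (hbound n x)) (by
      refine Metric.equicontinuous_of_continuity_modulus (fun d => γ * d) ?_ _ ?_
      · have : Continuous fun d : ℝ => γ * d := by fun_prop
        simpa using this.tendsto 0
      · rintro x y ⟨_, n, rfl⟩
        exact hflip n x y)
  obtain ⟨g, -, k, hk, hlim⟩ := hcomp.tendsto_subseq (x := f) fun n => subset_closure ⟨n, rfl⟩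
  have hlim2 : Tendsto (fun n => T ((r (k n) : ℝ) • f (k n))) atTop (𝓝 (T g)) := by
    refine (hTL.continuous.tendsto g).comp ?_
    simpa using (hrlim.comp hk.tendsto_atTop).smul hlim
  have hfix : T g = g := by
    refine tendsto_nhds_unique hlim2 (hlim.congr fun n => (hf (k n)).symm)
  refine ⟨g.toContinuousMap, fun x => ?_⟩
  have hx : τ (l g x) = g x := congrArg (fun h : BoundedContinuousFunction X ℝ => h x) hfix
  have := hτ (l g x)
  rw [hx, show l g x = logIntExp α ε (⇑g - C x) from rfl,
    exp_logIntExp hε (g.continuous.sub (hCx x))] at this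
  unfold marginalDensity
  convert this using 6
  · simp [add_sub_assoc]
  · rfl

end

/-! ### Lower bounds on divergences -/

theorem coe_integral_le_lintegral {Y : Type*} [MeasurableSpace Y] {μ : Measure Y} {h : Y → ℝ}
    {g : Y → ℝ≥0∞} (hh : Integrable h μ) (hle : ∀ y, ENNReal.ofReal (h y) ≤ g y) :
    ((∫ y, h y ∂μ : ℝ) : EReal) ≤ ((∫⁻ y, g y ∂μ : ℝ≥0∞) : EReal) := by
  have h1 : ENNReal.ofReal (∫ y, h y ∂μ) ≤ ∫⁻ y, g y ∂μ := by
    refine le_trans ?_ (lintegral_mono hle)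
    rw [integral_eq_lintegral_pos_part_sub_lintegral_neg_part hh]
    refine (ENNReal.ofReal_le_ofReal (sub_le_self _ ENNReal.toReal_nonneg)).trans
      ENNReal.ofReal_toReal_le
  refine le_trans ?_ (EReal.coe_ennreal_le_coe_ennreal_iff.2 h1)
  rw [EReal.coe_ennreal_ofReal]
  exact_mod_cast le_max_left _ _

/-- A finite bound `c` on `φ^*(q)` gives `φ p / p ≥ q - c / p`; then `p → ∞`. -/
theorem ofReal_le_recession {φ : ℝ≥0 → ℝ≥0∞} {q c : ℝ}
    (h : ∀ p : ℝ≥0, φ p ≠ ⊤ → (p : ℝ) * q - (φ p).toReal ≤ c) :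
    ENNReal.ofReal q ≤ recession φ := by
  have hlim : Tendsto (fun p : ℝ≥0 => ENNReal.ofReal (q - c / p)) atTop (𝓝 (ENNReal.ofReal q)) := by
    refine ENNReal.tendsto_ofReal ?_
    have : Tendsto (fun p : ℝ≥0 => c / (p : ℝ)) atTop (𝓝 0) :=
      tendsto_const_nhds.div_atTop (NNReal.tendsto_coe_atTop.2 tendsto_id)
    simpa using tendsto_const_nhds.sub this
  rw [← hlim.limsup_eq]
  refine limsup_le_limsup ?_
  filter_upwards [eventually_gt_atTop 0] with p hp
  have hp' : (0 : ℝ) < p := hp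
  rw [ENNReal.le_div_iff_mul_le (by simp [hp.ne']) (by simp)]
  by_cases hfin : φ p = ⊤
  · simp [hfin]
  · rw [← ENNReal.ofReal_coe_nnreal, ← ENNReal.ofReal_mul' (NNReal.coe_nonneg p)]
    refine ENNReal.ofReal_le_of_le_toReal ?_
    have := h p hfin
    have e : (q - c / p) * p = p * q - c := by field_simp
    linarith

theorem mul_sub_le_klFun {r : ℝ} (hr : 0 ≤ r) (h : ℝ) :
    r * h - (Real.exp h - 1) ≤ InformationTheory.klFun r := by
  rw [InformationTheory.klFun_apply]
  rcases hr.eq_or_lt with rfl | hr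
  · simp only [zero_mul]; linarith [Real.exp_pos h]
  · have h1 := mul_le_mul_of_nonneg_left (Real.add_one_le_exp (h - Real.log r)) hr.le
    rw [Real.exp_sub, Real.exp_log hr, mul_div_cancel₀ _ hr.ne'] at h1
    linarith

theorem integral_withDensity_rnDeriv {Y : Type*} [MeasurableSpace Y] (μ ν : Measure Y)
    [IsFiniteMeasure μ] [IsFiniteMeasure ν]
    (f : Y → ℝ) : ∫ y, f y ∂(ν.withDensity (μ.rnDeriv ν)) =
      ∫ y, (μ.rnDeriv ν y).toReal * f y ∂ν :=
  integral_withDensity_eq_integral_toReal_smul (Measure.measurable_rnDeriv μ ν)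
    (Measure.rnDeriv_lt_top μ ν) f

section

variable {Y : Type*} [TopologicalSpace Y] [CompactSpace Y] [MeasurableSpace Y] [BorelSpace Y]

theorem integrable_rnDeriv_mul (μ ν : Measure Y) [IsFiniteMeasure μ] [IsFiniteMeasure ν]
    {f : Y → ℝ} (hf : Continuous f) : Integrable (fun y => (μ.rnDeriv ν y).toReal * f y) ν := by
  have h1 : Integrable f (ν.withDensity (μ.rnDeriv ν)) :=
    (integrable_of_continuous μ hf).mono_measure (Measure.withDensity_rnDeriv_le μ ν)
  exact (integrable_withDensity_iff_integrable_smul' (Measure.measurable_rnDeriv μ ν)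
    (Measure.rnDeriv_lt_top μ ν)).1 h1

/-- Fenchel–Young holds pointwise on the absolutely continuous part, and the recession constant
dominates `f` on the singular part. -/
theorem le_csiszarDiv {φ : ℝ≥0 → ℝ≥0∞} (μ ν : Measure Y) [IsFiniteMeasure μ]
    [IsFiniteMeasure ν] {f P : Y → ℝ} (hf : Continuous f) (hP : Continuous P)
    (h : ∀ y, ∀ p : ℝ≥0, φ p ≠ ⊤ → (p : ℝ) * f y - (φ p).toReal ≤ P y) :
    ((∫ y, f y ∂μ - ∫ y, P y ∂ν : ℝ) : EReal) ≤ csiszarDiv φ μ ν := by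
  have hPi := integrable_of_continuous ν hP
  have hsing : ((∫ y, f y ∂(μ.singularPart ν) : ℝ) : EReal) ≤
      ((recession φ * μ.singularPart ν univ : ℝ≥0∞) : EReal) := by
    rw [← lintegral_const]
    exact coe_integral_le_lintegral (integrable_of_continuous _ hf) fun y =>
      ofReal_le_recession (h y)
  have hac : ((∫ y, (μ.rnDeriv ν y).toReal * f y ∂ν - ∫ y, P y ∂ν : ℝ) : EReal) ≤
      ((∫⁻ y, φ (μ.rnDeriv ν y).toNNReal ∂ν : ℝ≥0∞) : EReal) := by
    rw [← integral_sub (integrable_rnDeriv_mul μ ν hf) hPi]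
    refine coe_integral_le_lintegral ((integrable_rnDeriv_mul μ ν hf).sub hPi) fun y => ?_
    by_cases hfin : φ (μ.rnDeriv ν y).toNNReal = ⊤
    · simp [hfin]
    · refine ENNReal.ofReal_le_of_le_toReal ?_
      have := h y _ hfin
      rw [ENNReal.coe_toNNReal_eq_toReal] at this
      linarith
  have hsum : ∫ y, f y ∂μ = ∫ y, f y ∂(μ.singularPart ν) +
      ∫ y, (μ.rnDeriv ν y).toReal * f y ∂ν := by
    conv_lhs => rw [← Measure.singularPart_add_rnDeriv μ ν]
    rw [integral_add_measure (integrable_of_continuous _ hf) (integrable_of_continuous _ hf),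
      integral_withDensity_rnDeriv]
  unfold csiszarDiv
  rw [EReal.coe_ennreal_add, hsum]
  refine le_trans (le_of_eq ?_) (add_le_add hac hsing)
  rw [← EReal.coe_add]
  congr 1
  ring

theorem le_klDiv (μ ν : Measure Y) [IsFiniteMeasure μ] [IsFiniteMeasure ν] {h : Y → ℝ}
    (hh : Continuous h) :
    ((∫ y, h y ∂μ - ∫ y, (Real.exp (h y) - 1) ∂ν : ℝ) : EReal) ≤
      (InformationTheory.klDiv μ ν : ℝ≥0∞) := by
  by_cases hac : μ ≪ ν
  · rw [InformationTheory.klDiv_eq_lintegral_klFun_of_ac hac]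
    have hPi : Integrable (fun y => Real.exp (h y) - 1) ν :=
      integrable_of_continuous ν (by fun_prop)
    have e : ∫ y, h y ∂μ = ∫ y, (μ.rnDeriv ν y).toReal * h y ∂ν := by
      rw [← integral_withDensity_rnDeriv, Measure.withDensity_rnDeriv_eq μ ν hac]
    rw [e, ← integral_sub (integrable_rnDeriv_mul μ ν hh) hPi]
    exact coe_integral_le_lintegral ((integrable_rnDeriv_mul μ ν hh).sub hPi) fun y =>
      ENNReal.ofReal_le_ofReal (mul_sub_le_klFun ENNReal.toReal_nonneg _)
  · rw [InformationTheory.klDiv_of_not_ac hac]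
    simp

end

theorem coe_mul_le_coe_ofReal_mul {ε a : ℝ} (hε : 0 < ε) {k : ℝ≥0∞} (h : (a : EReal) ≤ k) :
    ((ε * a : ℝ) : EReal) ≤ ((ENNReal.ofReal ε * k : ℝ≥0∞) : EReal) := by
  by_cases hk : k = ⊤
  · rw [hk, ENNReal.mul_top (by simpa using hε)]; simp
  · lift k to ℝ≥0 using hk
    rw [ENNReal.ofReal, ← ENNReal.coe_mul]
    have h' : a ≤ k := EReal.coe_le_coe_iff.1 h
    change ((ε * a : ℝ) : EReal) ≤ (((ε.toNNReal * k : ℝ≥0) : ℝ) : EReal)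
    rw [EReal.coe_le_coe_iff, NNReal.coe_mul, Real.coe_toNNReal _ hε.le]
    exact mul_le_mul_of_nonneg_left h' hε.le

/-! ### Symmetric optimal potentials -/

section

variable {X : Type*} [TopologicalSpace X] [MeasurableSpace X]

/-- `f` is a symmetric optimal potential for `α`, with marginal density `s` and `P = φ^*(-f)`. -/
structure IsPotential (φ : ℝ≥0 → ℝ≥0∞) (C : X → X → ℝ) (ε : ℝ) (α : Measure X)
    (f s P : C(X, ℝ)) : Prop where
  density : ∀ x, s x = marginalDensity C ε α f x
  pair : ∀ x, SubgradientPair φ (s x).toNNReal (-f x)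
  conj_eq : ∀ x, P x = s x * -f x - (φ (s x).toNNReal).toReal

theorem IsPotential.nonneg {φ : ℝ≥0 → ℝ≥0∞} {C : X → X → ℝ} {ε : ℝ} {α : Measure X}
    {f s P : C(X, ℝ)} (h : IsPotential φ C ε α f s P) (x : X) : 0 ≤ s x := by
  rw [h.density]; exact integral_nonneg fun y => (Real.exp_pos _).le

theorem IsPotential.fenchel {φ : ℝ≥0 → ℝ≥0∞} {C : X → X → ℝ} {ε : ℝ} {α : Measure X}
    {f s P : C(X, ℝ)} (h : IsPotential φ C ε α f s P) (x : X) (p : ℝ≥0) (hp : φ p ≠ ⊤) :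
    (p : ℝ) * -f x - (φ p).toReal ≤ P x := by
  have := (h.pair x).2 p hp
  rw [Real.coe_toNNReal _ (h.nonneg x)] at this
  rw [h.conj_eq]
  linarith

theorem IsPotential.conj_neg {φ : ℝ≥0 → ℝ≥0∞} {C : X → X → ℝ} {ε : ℝ} {α : Measure X}
    {f s P : C(X, ℝ)} (h : IsPotential φ C ε α f s P) (x : X) : conj φ (-f x) = (P x : ℝ) := by
  rw [(h.pair x).conj_eq, h.conj_eq, Real.coe_toNNReal _ (h.nonneg x)]

end

/-! ### Duality for the transport cost -/

section

variable {X : Type*} [MetricSpace X] [CompactSpace X] [MeasurableSpace X] [BorelSpace X]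
  {φ : ℝ≥0 → ℝ≥0∞} {C : X → X → ℝ} {ε : ℝ}

/-- Weak duality. -/
theorem dual_le_otCost (hε : 0 < ε) (hC : Continuous (fun z : X × X => C z.1 z.2))
    (α β : FiniteMeasure X) (f g P Q : C(X, ℝ))
    (hf : ∀ x, ∀ p : ℝ≥0, φ p ≠ ⊤ → (p : ℝ) * -f x - (φ p).toReal ≤ P x)
    (hg : ∀ x, ∀ p : ℝ≥0, φ p ≠ ⊤ → (p : ℝ) * -g x - (φ p).toReal ≤ Q x) :
    ((-∫ x, P x ∂(α : Measure X) - ∫ x, Q x ∂(β : Measure X) -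
      ε * ∫ z, (Real.exp ((f z.1 + g z.2 - C z.1 z.2) / ε) - 1)
        ∂((α : Measure X).prod (β : Measure X)) : ℝ) : EReal) ≤ otCost φ C ε α β := by
  refine le_iInf fun π => ?_
  have hfc : Continuous fun x => -f x := by fun_prop
  have hgc : Continuous fun x => -g x := by fun_prop
  have hf1 : Continuous fun z : X × X => f z.1 := by fun_prop
  have hg1 : Continuous fun z : X × X => g z.2 := by fun_prop
  have hh : Continuous fun z : X × X => (f z.1 + g z.2 - C z.1 z.2) / ε := by fun_prop
  have h1 := le_csiszarDiv (π : Measure (X × X)).fst (α : Measure X) hfc P.continuous hf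
  have h2 := le_csiszarDiv (π : Measure (X × X)).snd (β : Measure X) hgc Q.continuous hg
  have h3 := coe_mul_le_coe_ofReal_mul hε (le_klDiv (π : Measure (X × X))
    ((α : Measure X).prod (β : Measure X)) hh)
  have e1 : ∫ x, -f x ∂(π : Measure (X × X)).fst = -∫ z, f z.1 ∂(π : Measure (X × X)) := by
    rw [integral_neg, Measure.fst, integral_map measurable_fst.aemeasurable
      f.continuous.aestronglyMeasurable]
  have e2 : ∫ x, -g x ∂(π : Measure (X × X)).snd = -∫ z, g z.2 ∂(π : Measure (X × X)) := by
    rw [integral_neg, Measure.snd, integral_map measurable_snd.aemeasurable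
      g.continuous.aestronglyMeasurable]
  have e3 : ε * ∫ z, (f z.1 + g z.2 - C z.1 z.2) / ε ∂(π : Measure (X × X)) =
      ∫ z, f z.1 ∂(π : Measure (X × X)) + ∫ z, g z.2 ∂(π : Measure (X × X)) -
        ∫ z, C z.1 z.2 ∂(π : Measure (X × X)) := by
    rw [integral_div, integral_sub (integrable_of_continuous _ (by fun_prop))
      (integrable_of_continuous _ hC), integral_add (integrable_of_continuous _ hf1)
      (integrable_of_continuous _ hg1)]
    field_simp
  rw [e1] at h1
  rw [e2] at h2
  rw [mul_sub, e3] at h3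
  rw [EReal.coe_ennreal_add, EReal.coe_ennreal_add]
  -- The integrals of `f`, `g` and `C` against `π` cancel, leaving a bound independent of the plan.
  refine le_trans (le_of_eq ?_) (add_le_add le_rfl (add_le_add (add_le_add h1 h2) h3))
  simp only [← EReal.coe_add]
  congr 1
  ring

/-! ### Marginals and divergences of measures given by densities -/

theorem fst_withDensity_prod (α β : Measure X) [IsFiniteMeasure α] [IsFiniteMeasure β]
    {k : X × X → ℝ} (hk : Continuous k) (hk0 : ∀ z, 0 ≤ k z) :
    ((α.prod β).withDensity fun z => ENNReal.ofReal (k z)).fst =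
      α.withDensity fun x => ENNReal.ofReal (∫ y, k (x, y) ∂β) := by
  ext s hs
  rw [Measure.fst_apply hs, withDensity_apply _ (measurable_fst hs), withDensity_apply _ hs,
    ← prod_univ, ← Measure.prod_restrict, Measure.restrict_univ,
    lintegral_prod _ hk.measurable.ennreal_ofReal.aemeasurable]
  refine lintegral_congr fun x => ?_
  exact (ofReal_integral_eq_lintegral_ofReal
    (integrable_of_continuous β (hk.comp (Continuous.prodMk_right x)))
    (ae_of_all _ fun y => hk0 _)).symm

theorem snd_withDensity_prod (α β : Measure X) [IsFiniteMeasure α] [IsFiniteMeasure β]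
    {k : X × X → ℝ} (hk : Continuous k) (hk0 : ∀ z, 0 ≤ k z) :
    ((α.prod β).withDensity fun z => ENNReal.ofReal (k z)).snd =
      β.withDensity fun y => ENNReal.ofReal (∫ x, k (x, y) ∂α) := by
  ext s hs
  rw [Measure.snd_apply hs, withDensity_apply _ (measurable_snd hs), withDensity_apply _ hs,
    ← univ_prod, ← Measure.prod_restrict, Measure.restrict_univ,
    lintegral_prod_symm _ hk.measurable.ennreal_ofReal.aemeasurable]
  refine lintegral_congr fun y => ?_
  exact (ofReal_integral_eq_lintegral_ofReal
    (integrable_of_continuous α (hk.comp (Continuous.prodMk_left y)))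
    (ae_of_all _ fun y => hk0 _)).symm

theorem isFiniteMeasure_withDensity_continuous {Y : Type*} [TopologicalSpace Y] [CompactSpace Y]
    [MeasurableSpace Y] [BorelSpace Y] (μ : Measure Y) [IsFiniteMeasure μ] {k : Y → ℝ}
    (hk : Continuous k) : IsFiniteMeasure (μ.withDensity fun z => ENNReal.ofReal (k z)) :=
  isFiniteMeasure_withDensity_ofReal (integrable_of_continuous μ hk).2

theorem csiszarDiv_withDensity {Y : Type*} [MeasurableSpace Y] (ν : Measure Y) [IsFiniteMeasure ν]
    {ρ : Y → ℝ≥0∞} (hρ : Measurable ρ) :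
    csiszarDiv φ (ν.withDensity ρ) ν = ∫⁻ y, φ (ρ y).toNNReal ∂ν := by
  unfold csiszarDiv
  rw [Measure.singularPart_withDensity]
  simp only [Measure.coe_zero, Pi.zero_apply, mul_zero, add_zero]
  refine lintegral_congr_ae ?_
  filter_upwards [Measure.rnDeriv_withDensity ν hρ] with y hy
  rw [hy]

theorem klDiv_withDensity {Y : Type*} [MeasurableSpace Y] (ν : Measure Y) [IsFiniteMeasure ν]
    {ρ : Y → ℝ≥0∞} (hρ : Measurable ρ) [IsFiniteMeasure (ν.withDensity ρ)] :
    InformationTheory.klDiv (ν.withDensity ρ) ν =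
      ∫⁻ y, ENNReal.ofReal (InformationTheory.klFun (ρ y).toReal) ∂ν := by
  rw [InformationTheory.klDiv_eq_lintegral_klFun_of_ac (withDensity_absolutelyContinuous ν ρ)]
  refine lintegral_congr_ae ?_
  filter_upwards [Measure.rnDeriv_withDensity ν hρ] with y hy
  rw [hy]

theorem otCost_ne_bot (hε : 0 < ε) (hC : Continuous (fun z : X × X => C z.1 z.2))
    (α β : FiniteMeasure X) : otCost φ C ε α β ≠ ⊥ := by
  have h := dual_le_otCost (φ := φ) hε hC α β 0 0 0 0 (fun x p _ => by simp) (fun x p _ => by simp)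
  intro hb
  rw [hb, le_bot_iff] at h
  exact EReal.coe_ne_bot _ h

theorem otCost_ne_top (hφ : IsEntropyFunction φ) (hφ₂ : ConjExtremeSlopes φ)
    (α β : FiniteMeasure X) (hα : α ≠ 0) (hβ : β ≠ 0) :
    otCost φ C ε α β ≠ ⊤ := by
  have hα' : 0 < α.mass := pos_iff_ne_zero.2 ((FiniteMeasure.mass_nonzero_iff α).2 hα)
  have hβ' : 0 < β.mass := pos_iff_ne_zero.2 ((FiniteMeasure.mass_nonzero_iff β).2 hβ)
  -- The plan `c α ⊗ β` has marginal densities `c * β.mass` and `c * α.mass`; both must lie in the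
  -- domain of `φ`.
  obtain ⟨c, h1, h2⟩ := hφ₂.exists_scaling hφ hα' hβ'
  have hk : Continuous fun _ : X × X => (c : ℝ) := continuous_const
  have := isFiniteMeasure_withDensity_continuous ((α : Measure X).prod (β : Measure X)) hk
  let π : FiniteMeasure (X × X) := ⟨_, this⟩
  refine ne_top_of_le_ne_top ?_ (iInf_le _ π)
  have e1 : csiszarDiv φ (π : Measure (X × X)).fst (α : Measure X) ≠ ⊤ := by
    change csiszarDiv φ (((α : Measure X).prod (β : Measure X)).withDensity _).fst _ ≠ ⊤
    rw [fst_withDensity_prod _ _ hk fun _ => c.2, csiszarDiv_withDensity _ (by fun_prop)]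
    simp only [integral_const, smul_eq_mul, lintegral_const]
    refine ENNReal.mul_ne_top ?_ (measure_ne_top _ _)
    convert h2
    rw [show (β : Measure X).real univ = β.mass from rfl, mul_comm, ← NNReal.coe_mul,
      ENNReal.ofReal_coe_nnreal, ENNReal.toNNReal_coe]
  have e2 : csiszarDiv φ (π : Measure (X × X)).snd (β : Measure X) ≠ ⊤ := by
    change csiszarDiv φ (((α : Measure X).prod (β : Measure X)).withDensity _).snd _ ≠ ⊤
    rw [snd_withDensity_prod _ _ hk fun _ => c.2, csiszarDiv_withDensity _ (by fun_prop)]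
    simp only [integral_const, smul_eq_mul, lintegral_const]
    refine ENNReal.mul_ne_top ?_ (measure_ne_top _ _)
    convert h1
    rw [show (α : Measure X).real univ = α.mass from rfl, mul_comm, ← NNReal.coe_mul,
      ENNReal.ofReal_coe_nnreal, ENNReal.toNNReal_coe]
  have e3 : InformationTheory.klDiv (π : Measure (X × X))
      ((α : Measure X).prod (β : Measure X)) ≠ ⊤ := by
    change InformationTheory.klDiv (((α : Measure X).prod (β : Measure X)).withDensity _) _ ≠ ⊤
    rw [klDiv_withDensity _ (by fun_prop), lintegral_const]
    exact ENNReal.mul_ne_top ENNReal.ofReal_ne_top (measure_ne_top _ _)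
  have e4 := ENNReal.add_ne_top.2 ⟨ENNReal.add_ne_top.2 ⟨e1, e2⟩,
    ENNReal.mul_ne_top (ENNReal.ofReal_ne_top (r := ε)) e3⟩
  refine EReal.add_ne_top (EReal.coe_ne_top _) ?_
  exact fun h => e4 (EReal.coe_ennreal_eq_top_iff.1 h)

theorem exists_isPotential (hφ : IsEntropyFunction φ) (hε : 0 < ε)
    (hC_cont : Continuous (fun z : X × X => C z.1 z.2))
    (hC_diag : ∀ x, C x x = 0) {γ : ℝ≥0} (hC_lip : ∀ x y z, |C x z - C y z| ≤ γ * dist x y)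
    (α : Measure X) [IsFiniteMeasure α] [NeZero α] :
    ∃ f s P : C(X, ℝ), IsPotential φ C ε α f s P := by
  obtain ⟨f, hf⟩ := exists_potential (α := α) hφ hε hC_cont hC_diag hC_lip
  have hs : Continuous fun x => marginalDensity C ε α f x := by
    unfold marginalDensity
    have h1 : Continuous (Function.uncurry fun x y => Real.exp ((f x + f y - C x y) / ε)) := by
      simp only [Function.uncurry_def]; fun_prop
    have := continuous_parametric_integral_of_continuous (μ := α) h1 isCompact_univ
    simpa using this
  have hs0 : ∀ x, 0 ≤ marginalDensity C ε α f x := fun x =>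
    integral_nonneg fun y => (Real.exp_pos _).le
  set P : X → ℝ := fun x => marginalDensity C ε α f x * -f x -
    (φ (marginalDensity C ε α f x).toNNReal).toReal with hPdef
  -- The density is a subgradient of `φ^*` at `-f x`. Used in both directions, this squeezes `P`
  -- between continuous functions, with no continuity of `φ` needed.
  have hsub : ∀ x y, P x + marginalDensity C ε α f x * (f x - f y) ≤ P y := by
    intro x y
    have := (hf y).2 _ (hf x).1
    rw [Real.coe_toNNReal _ (hs0 _), Real.coe_toNNReal _ (hs0 _)] at this
    simp only [hPdef]
    linarith
  have hP : Continuous P := by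
    rw [continuous_iff_continuousAt]
    intro x
    have h1 : Tendsto (fun y => P x + marginalDensity C ε α f x * (f x - f y)) (𝓝 x) (𝓝 (P x)) := by
      have : Continuous fun y => P x + marginalDensity C ε α f x * (f x - f y) := by fun_prop
      simpa using this.tendsto x
    have h2 : Tendsto (fun y => P x - marginalDensity C ε α f y * (f y - f x)) (𝓝 x) (𝓝 (P x)) := by
      have : Continuous fun y => P x - marginalDensity C ε α f y * (f y - f x) := by fun_prop
      simpa using this.tendsto x
    exact tendsto_of_tendsto_of_tendsto_of_le_of_le h1 h2 (fun y => hsub x y)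
      (fun y => by linarith [hsub y x])
  exact ⟨f, ⟨_, hs⟩, ⟨P, hP⟩, fun x => rfl, hf, fun x => rfl⟩

/-- The plan built from a symmetric optimal potential attains the dual value. -/
theorem IsPotential.otCost_le (hε : 0 < ε) (hC : Continuous (fun z : X × X => C z.1 z.2))
    (hC_symm : ∀ x y, C x y = C y x) {α : FiniteMeasure X} {f s P : C(X, ℝ)}
    (h : IsPotential φ C ε (α : Measure X) f s P) :
    otCost φ C ε α α ≤ ((-2 * ∫ x, P x ∂(α : Measure X) -
      ε * ∫ z, (Real.exp ((f z.1 + f z.2 - C z.1 z.2) / ε) - 1)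
        ∂((α : Measure X).prod (α : Measure X)) : ℝ) : EReal) := by
  set η : X × X → ℝ := fun z => (f z.1 + f z.2 - C z.1 z.2) / ε with hη
  set k : X × X → ℝ := fun z => Real.exp (η z) with hk'
  have hηc : Continuous η := by fun_prop
  have hk : Continuous k := by fun_prop
  have hk0 : ∀ z, 0 ≤ k z := fun z => (Real.exp_pos _).le
  set αα := (α : Measure X).prod (α : Measure X) with hαα
  have hfin := isFiniteMeasure_withDensity_continuous αα hk
  let π : FiniteMeasure (X × X) := ⟨_, hfin⟩
  have hπ : (π : Measure (X × X)) = αα.withDensity fun z => ENNReal.ofReal (k z) := rfl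
  have hsk : ∀ x, ∫ y, k (x, y) ∂(α : Measure X) = s x := fun x => (h.density x).symm
  have hks : ∀ x y, k (x, y) = k (y, x) := fun x y => by
    simp only [hk', hη]; rw [hC_symm, add_comm (f x)]
  have hfst : (π : Measure (X × X)).fst =
      (α : Measure X).withDensity fun x => ENNReal.ofReal (s x) := by
    rw [hπ, fst_withDensity_prod _ _ hk hk0]; simp_rw [hsk]
  have hsnd : (π : Measure (X × X)).snd =
      (α : Measure X).withDensity fun x => ENNReal.ofReal (s x) := by
    rw [hπ, snd_withDensity_prod _ _ hk hk0]; simp_rw [fun y x => hks x y, hsk]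
  have hdiv : csiszarDiv φ ((α : Measure X).withDensity fun x => ENNReal.ofReal (s x)) α =
      ENNReal.ofReal (∫ x, (s x * -f x - P x) ∂(α : Measure X)) := by
    rw [csiszarDiv_withDensity _ (by fun_prop)]
    -- Equality case of Fenchel–Young, which is why there is no duality gap for this plan.
    have e : ∀ x, φ (ENNReal.ofReal (s x)).toNNReal = ENNReal.ofReal (s x * -f x - P x) := by
      intro x
      rw [h.conj_eq, sub_sub_cancel, ENNReal.ofReal_toReal (h.pair x).1]
      rfl
    simp_rw [e]
    rw [ofReal_integral_eq_lintegral_ofReal (integrable_of_continuous _ (by fun_prop))]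
    refine ae_of_all _ fun x => ?_
    simp only [Pi.zero_apply]
    rw [h.conj_eq, sub_sub_cancel]
    exact ENNReal.toReal_nonneg
  have hdiv0 : 0 ≤ ∫ x, (s x * -f x - P x) ∂(α : Measure X) := by
    refine integral_nonneg fun x => ?_
    rw [Pi.zero_apply, h.conj_eq, sub_sub_cancel]
    exact ENNReal.toReal_nonneg
  have hkl : InformationTheory.klDiv (π : Measure (X × X)) αα =
      ENNReal.ofReal (∫ z, (k z * η z + 1 - k z) ∂αα) := by
    rw [hπ, klDiv_withDensity _ (by fun_prop)]
    have e : ∀ z, InformationTheory.klFun (ENNReal.ofReal (k z)).toReal = k z * η z + 1 - k z := by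
      intro z
      rw [ENNReal.toReal_ofReal (hk0 z), InformationTheory.klFun_apply, hk']
      simp only [Real.log_exp]
    rw [ofReal_integral_eq_lintegral_ofReal (integrable_of_continuous _ (by fun_prop))]
    · simp_rw [e]
    · refine ae_of_all _ fun z => ?_
      simp only [Pi.zero_apply]
      rw [← e]
      exact InformationTheory.klFun_nonneg ENNReal.toReal_nonneg
  have hkl0 : 0 ≤ ∫ z, (k z * η z + 1 - k z) ∂αα := by
    refine integral_nonneg fun z => ?_
    have := InformationTheory.klFun_nonneg (hk0 z)
    rw [InformationTheory.klFun_apply] at this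
    simp only [hk', Real.log_exp] at this
    exact this
  have hCπ : ∫ z, C z.1 z.2 ∂(π : Measure (X × X)) = ∫ z, k z * C z.1 z.2 ∂αα := by
    rw [hπ, integral_withDensity_eq_integral_toReal_smul (by fun_prop) (ae_of_all _ fun z => by simp)]
    simp_rw [ENNReal.toReal_ofReal (hk0 _), smul_eq_mul]
  have hs1 : ∫ z, k z * f z.1 ∂αα = ∫ x, s x * f x ∂(α : Measure X) := by
    rw [hαα, integral_prod _ (integrable_of_continuous _ (by fun_prop))]
    refine integral_congr_ae (ae_of_all _ fun x => ?_)
    simp only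
    rw [integral_mul_const, hsk]
  have hs2 : ∫ z, k z * f z.2 ∂αα = ∫ x, s x * f x ∂(α : Measure X) := by
    rw [hαα, integral_prod_symm _ (integrable_of_continuous _ (by fun_prop))]
    refine integral_congr_ae (ae_of_all _ fun x => ?_)
    simp only
    rw [integral_mul_const]
    simp_rw [fun y => hks y x, hsk]
  have hεkl : ε * ∫ z, (k z * η z + 1 - k z) ∂αα = 2 * ∫ x, s x * f x ∂(α : Measure X) -
      ∫ z, k z * C z.1 z.2 ∂αα - ε * ∫ z, (k z - 1) ∂αα := by
    have e : ∀ z, ε * (k z * η z + 1 - k z) =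
        k z * f z.1 + k z * f z.2 - k z * C z.1 z.2 - ε * (k z - 1) := by
      intro z; simp only [hη]; field_simp; ring
    rw [← integral_const_mul]
    simp_rw [e]
    rw [integral_sub (integrable_of_continuous _ (by fun_prop))
      (integrable_of_continuous _ (by fun_prop)), integral_sub (integrable_of_continuous _ (by fun_prop))
      (integrable_of_continuous _ (by fun_prop)), integral_add (integrable_of_continuous _ (by fun_prop))
      (integrable_of_continuous _ (by fun_prop)), hs1, hs2, integral_const_mul]
    ring
  have hsP : ∫ x, (s x * -f x - P x) ∂(α : Measure X) =
      -∫ x, s x * f x ∂(α : Measure X) - ∫ x, P x ∂(α : Measure X) := by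
    simp_rw [mul_neg]
    rw [integral_sub (integrable_of_continuous _ (by fun_prop))
      (integrable_of_continuous _ (by fun_prop)), integral_neg]
  refine (iInf_le _ π).trans (le_of_eq ?_)
  rw [hfst, hsnd, hdiv, hkl, ← ENNReal.ofReal_mul hε.le, ← ENNReal.ofReal_add hdiv0 hdiv0,
    ← ENNReal.ofReal_add (by positivity) (by positivity), EReal.coe_ennreal_ofReal,
    max_eq_left (by positivity), ← EReal.coe_add, hCπ, hεkl, hsP]
  congr 1
  ring

end

/-! ### Integrals of extended-real functions and pairings -/

theorem coe_lintegral_sub_lintegral_neg {Y : Type*} [MeasurableSpace Y] {μ : Measure Y}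
    {L : Y → ℝ} (hL : Integrable L μ) :
    ((∫⁻ y, ENNReal.ofReal (L y) ∂μ : ℝ≥0∞) : EReal) -
      ((∫⁻ y, ENNReal.ofReal (-L y) ∂μ : ℝ≥0∞) : EReal) = ((∫ y, L y ∂μ : ℝ) : EReal) := by
  have h1 : ∫⁻ y, ENNReal.ofReal (L y) ∂μ ≠ ⊤ := hL.lintegral_lt_top.ne
  have h2 : ∫⁻ y, ENNReal.ofReal (-L y) ∂μ ≠ ⊤ := hL.neg.lintegral_lt_top.ne
  rw [integral_eq_lintegral_pos_part_sub_lintegral_neg_part hL, EReal.coe_sub,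
    EReal.coe_ennreal_toReal h1, EReal.coe_ennreal_toReal h2]

theorem eintegral_coe {Y : Type*} [MeasurableSpace Y] {μ : Measure Y}
    {L : Y → ℝ} (hL : Integrable L μ) :
    eintegral μ (fun y => (L y : EReal)) = ((∫ y, L y ∂μ : ℝ) : EReal) := by
  rw [← coe_lintegral_sub_lintegral_neg hL]
  simp only [eintegral, ← EReal.coe_neg, EReal.real_coe_toENNReal]

theorem eintegral_mono {Y : Type*} [MeasurableSpace Y] {μ : Measure Y} {F G : Y → EReal}
    (h : ∀ y, F y ≤ G y) : eintegral μ F ≤ eintegral μ G := by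
  unfold eintegral
  refine EReal.sub_le_sub (EReal.coe_ennreal_le_coe_ennreal_iff.2 ?_)
    (EReal.coe_ennreal_le_coe_ennreal_iff.2 ?_)
  · exact lintegral_mono fun y => EReal.toENNReal_le_toENNReal (h y)
  · exact lintegral_mono fun y => EReal.toENNReal_le_toENNReal (EReal.neg_le_neg_iff.2 (h y))

theorem exists_toSigned_sub {Y : Type*} [MeasurableSpace Y] (δ : SignedMeasure Y) :
    ∃ a b : FiniteMeasure Y, δ = toSigned a - toSigned b :=
  ⟨⟨δ.toJordanDecomposition.posPart, inferInstance⟩,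
    ⟨δ.toJordanDecomposition.negPart, inferInstance⟩,
    δ.toSignedMeasure_toJordanDecomposition.symm⟩

theorem toSigned_injective {Y : Type*} [MeasurableSpace Y] :
    Function.Injective (toSigned : FiniteMeasure Y → SignedMeasure Y) := fun a b h =>
  Subtype.ext ((Measure.toSignedMeasure_eq_toSignedMeasure_iff (μ := (a : Measure Y))
    (ν := (b : Measure Y))).1 h)

section

variable {Y : Type*} [TopologicalSpace Y] [CompactSpace Y] [MeasurableSpace Y] [BorelSpace Y]

theorem integrable_toSigned (a : FiniteMeasure Y) {g : Y → ℝ} (hg : Continuous g) :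
    (toSigned a).Integrable g := by
  have : (toSigned a).variation = a := Measure.variation_toSignedMeasure
  rw [VectorMeasure.Integrable, this]
  exact integrable_of_continuous _ hg

theorem pairing_toSigned {Y : Type*} [MeasurableSpace Y] (a : FiniteMeasure Y) (g : Y → ℝ) :
    pairing (toSigned a) g = ∫ y, g y ∂(a : Measure Y) :=
  VectorMeasure.integral_toSignedMeasure

theorem pairing_toSigned_sub (a b : FiniteMeasure Y) {g : Y → ℝ} (hg : Continuous g) :
    pairing (toSigned a - toSigned b) g = ∫ y, g y ∂(a : Measure Y) - ∫ y, g y ∂(b : Measure Y) := by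
  rw [← pairing_toSigned, ← pairing_toSigned]
  exact VectorMeasure.integral_sub_vectorMeasure (integrable_toSigned a hg)
    (integrable_toSigned b hg)

theorem integral_of_toSigned_eq {α α' a b : FiniteMeasure Y} {t : ℝ}
    (h : toSigned α' = toSigned α + t • (toSigned a - toSigned b)) {g : Y → ℝ}
    (hg : Continuous g) :
    ∫ y, g y ∂(α' : Measure Y) = ∫ y, g y ∂(α : Measure Y) +
      t * (∫ y, g y ∂(a : Measure Y) - ∫ y, g y ∂(b : Measure Y)) := by
  rw [← pairing_toSigned_sub a b hg, ← pairing_toSigned, ← pairing_toSigned, h]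
  refine (VectorMeasure.integral_add_vectorMeasure (integrable_toSigned α hg)
    (((integrable_toSigned a hg).sub_vectorMeasure (integrable_toSigned b hg)).smul_vectorMeasure
      t)).trans ?_
  congr 1
  exact VectorMeasure.integral_smul_vectorMeasure g t

end

/-! ### The gradient of the Sinkhorn entropy -/

/-- The Gibbs kernel `exp((f x + f y - C x y) / ε)`. -/
noncomputable def gibbs {X : Type*} [TopologicalSpace X] (C : X → X → ℝ) (ε : ℝ)
    (f : C(X, ℝ)) (x y : X) : ℝ :=
  Real.exp ((f x + f y - C x y) / ε)

theorem continuous_gibbs {X : Type*} [TopologicalSpace X] {C : X → X → ℝ}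
    (hC : Continuous (fun z : X × X => C z.1 z.2)) (ε : ℝ) (f : C(X, ℝ)) :
    Continuous fun z : X × X => gibbs C ε f z.1 z.2 := by
  unfold gibbs; fun_prop

theorem gibbs_symm {X : Type*} [TopologicalSpace X] {C : X → X → ℝ}
    (hC_symm : ∀ x y, C x y = C y x) (ε : ℝ) (f : C(X, ℝ)) (x y : X) :
    gibbs C ε f x y = gibbs C ε f y x := by
  unfold gibbs; rw [hC_symm, add_comm (f x)]

section

variable {X : Type*} [MetricSpace X] [CompactSpace X] [MeasurableSpace X] [BorelSpace X]
  {φ : ℝ≥0 → ℝ≥0∞} {C : X → X → ℝ} {ε : ℝ}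

theorem continuous_integral_left (hC : Continuous (fun z : X × X => C z.1 z.2)) (μ : Measure X)
    [IsFiniteMeasure μ] : Continuous fun x => ∫ y, C x y ∂μ := by
  simpa using continuous_parametric_integral_of_continuous (μ := μ) (f := C) hC isCompact_univ

/-- The value at `f` of minus the dual functional. -/
noncomputable def entropyValue (C : X → X → ℝ) (ε : ℝ) (f P : C(X, ℝ)) (μ : FiniteMeasure X) : ℝ :=
  ∫ x, P x ∂(μ : Measure X) +
    ε / 2 * ∫ z, gibbs C ε f z.1 z.2 ∂((μ : Measure X).prod (μ : Measure X))

namespace IsPotential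

variable {α : FiniteMeasure X} {f s P : C(X, ℝ)}

/-- A witness `p` of the strict inequality at one point still works nearby, since `f`, `s` and `P`
are continuous; compactness makes the gap uniform. -/
theorem exists_gap (hφ₁ : ConjStrictlyConvex φ) (h : IsPotential φ C ε (α : Measure X) f s P)
    {σ : ℝ} (hσ : σ ≠ 0) :
    ∃ c > 0, ∀ x, ∃ p : ℝ≥0, φ p ≠ ⊤ ∧
      P x + s x * σ + c ≤ (p : ℝ) * (-f x + σ) - (φ p).toReal := by
  have key : ∃ c > 0, ∀ x ∈ (univ : Set X), ∃ p : ℝ≥0, φ p ≠ ⊤ ∧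
      P x + s x * σ + c ≤ (p : ℝ) * (-f x + σ) - (φ p).toReal := by
    refine isCompact_univ.induction_on (p := fun U => ∃ c > 0, ∀ x ∈ U, ∃ p : ℝ≥0, φ p ≠ ⊤ ∧
      P x + s x * σ + c ≤ (p : ℝ) * (-f x + σ) - (φ p).toReal) ?_ ?_ ?_ ?_
    · exact ⟨1, one_pos, fun x hx => absurd hx (notMem_empty x)⟩
    · rintro U V hUV ⟨c, hc, H⟩
      exact ⟨c, hc, fun x hx => H x (hUV hx)⟩
    · rintro U V ⟨c, hc, H⟩ ⟨d, hd, K⟩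
      refine ⟨min c d, lt_min hc hd, ?_⟩
      rintro x (hx | hx)
      · obtain ⟨p, hp, hle⟩ := H x hx
        exact ⟨p, hp, by linarith [min_le_left c d]⟩
      · obtain ⟨p, hp, hle⟩ := K x hx
        exact ⟨p, hp, by linarith [min_le_right c d]⟩
    · intro x _
      obtain ⟨p, hp, hlt⟩ := hφ₁.exists_lt (h.pair x) hσ
      rw [Real.coe_toNNReal _ (h.nonneg x)] at hlt
      have hlt' : P x + s x * σ < (p : ℝ) * (-f x + σ) - (φ p).toReal := by
        rw [h.conj_eq]; linarith
      obtain ⟨c, hc⟩ : ∃ c : ℝ, 0 < c ∧ P x + s x * σ + c < (p : ℝ) * (-f x + σ) - (φ p).toReal :=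
        ⟨((p : ℝ) * (-f x + σ) - (φ p).toReal - (P x + s x * σ)) / 2, by linarith, by linarith⟩
      have hev : ∀ᶠ y in 𝓝 x, P y + s y * σ + c < (p : ℝ) * (-f y + σ) - (φ p).toReal := by
        have h1 : Continuous fun y => P y + s y * σ + c := by fun_prop
        have h2 : Continuous fun y => (p : ℝ) * (-f y + σ) - (φ p).toReal := by fun_prop
        exact h1.continuousAt.eventually_lt h2.continuousAt hc.2
      exact ⟨_, mem_nhdsWithin_of_mem_nhds hev, c, hc.1, fun y hy => ⟨p, hp, le_of_lt hy⟩⟩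
  obtain ⟨c, hc, H⟩ := key
  exact ⟨c, hc, fun x => H x (mem_univ x)⟩

/-- Strict convexity of the conjugate yields a uniform linear growth of its Bregman divergence. -/
theorem exists_growth (hφ₁ : ConjStrictlyConvex φ) (h : IsPotential φ C ε (α : Measure X) f s P)
    {ρ : ℝ} (hρ : 0 < ρ) :
    ∃ c > 0, ∀ x q, ((P x + s x * (f x - q) + c * (|f x - q| - ρ) : ℝ) : EReal) ≤ conj φ (-q) := by
  obtain ⟨c₁, hc₁, H₁⟩ := h.exists_gap hφ₁ hρ.ne'
  obtain ⟨c₂, hc₂, H₂⟩ := h.exists_gap hφ₁ (neg_ne_zero.2 hρ.ne')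
  have hc : 0 < min c₁ c₂ / ρ := div_pos (lt_min hc₁ hc₂) hρ
  refine ⟨min c₁ c₂ / ρ, hc, fun x q => ?_⟩
  set c := min c₁ c₂ / ρ with hcdef
  have hcρ : c * ρ = min c₁ c₂ := by rw [hcdef]; field_simp
  suffices ∃ p : ℝ≥0, φ p ≠ ⊤ ∧ P x + s x * (f x - q) + c * (|f x - q| - ρ) ≤
      (p : ℝ) * -q - (φ p).toReal by
    obtain ⟨p, hp, hle⟩ := this
    exact (EReal.coe_le_coe_iff.2 hle).trans (coe_le_conj _ hp)
  rcases le_or_gt |f x - q| ρ with hle | hgt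
  · refine ⟨(s x).toNNReal, (h.pair x).1, ?_⟩
    rw [Real.coe_toNNReal _ (h.nonneg x), h.conj_eq]
    nlinarith
  · rcases le_total 0 (f x - q) with h0 | h0
    -- The gap at distance `ρ` forces `p - s x ≥ c`, so the affine minorant given by `p` keeps
    -- growing beyond `ρ`. The other sign is symmetric.
    · rw [abs_of_nonneg h0] at hgt ⊢
      obtain ⟨p, hp, hle⟩ := H₁ x
      refine ⟨p, hp, ?_⟩
      have hD := h.fenchel x p hp
      have hcm : c * ρ ≤ c₁ := hcρ.trans_le (min_le_left _ _)
      have h1 : c * ρ ≤ (p - s x) * ρ := by linarith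
      have h2 : c ≤ p - s x := le_of_mul_le_mul_right h1 hρ
      nlinarith
    · rw [abs_of_nonpos h0] at hgt ⊢
      obtain ⟨p, hp, hle⟩ := H₂ x
      refine ⟨p, hp, ?_⟩
      have hD := h.fenchel x p hp
      have hcm : c * ρ ≤ c₂ := hcρ.trans_le (min_le_right _ _)
      have h1 : c * ρ ≤ (s x - p) * ρ := by linarith
      have h2 : c ≤ s x - p := le_of_mul_le_mul_right h1 hρ
      nlinarith

theorem sinkhornEntropy_le (h : IsPotential φ C ε (α : Measure X) f s P) (μ : FiniteMeasure X) :
    sinkhornEntropy φ C ε μ ≤ (entropyValue C ε f P μ : ℝ) := by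
  unfold sinkhornEntropy
  rw [EReal.neg_le, ← EReal.coe_neg]
  refine le_trans (le_of_eq ?_) (le_iSup _ f)
  simp only [h.conj_neg, ← EReal.coe_neg]
  rw [eintegral_coe (integrable_of_continuous _ (by fun_prop)), ← EReal.coe_sub, integral_neg]
  congr 1
  unfold entropyValue gibbs
  ring

/-- For a competitor `g`, the exponential is bounded below by its tangent at `f`, whose linear term
involves the density `s'` of `μ` instead of `s`. The mismatch is at most `κ |f - g|`: within
distance `ρ` it costs at most `κ ρ`, and beyond `ρ` the growth of `φ^*` absorbs the excess. -/
theorem le_sinkhornEntropy (hε : 0 < ε) (hC : Continuous (fun z : X × X => C z.1 z.2))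
    (hC_symm : ∀ x y, C x y = C y x)
    (h : IsPotential φ C ε (α : Measure X) f s P) {ρ c κ : ℝ} (hκc : κ ≤ c)
    (hgrowth : ∀ x q,
      ((P x + s x * (f x - q) + c * (|f x - q| - ρ) : ℝ) : EReal) ≤ conj φ (-q))
    (μ : FiniteMeasure X) (hκ : ∀ x, |∫ y, gibbs C ε f x y ∂(μ : Measure X) - s x| ≤ κ) :
    ((entropyValue C ε f P μ - κ * ρ * μ.mass : ℝ) : EReal) ≤ sinkhornEntropy φ C ε μ := by
  unfold sinkhornEntropy
  rw [EReal.le_neg, ← EReal.coe_neg]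
  refine iSup_le fun g => ?_
  set E : X × X → ℝ := fun z => gibbs C ε f z.1 z.2 with hE
  have hEc : Continuous E := continuous_gibbs hC ε f
  set s' : X → ℝ := fun x => ∫ y, gibbs C ε f x y ∂(μ : Measure X) with hs'
  have hs'c : Continuous s' := continuous_integral_left (continuous_gibbs hC ε f) _
  set L : X → ℝ := fun x => P x + s' x * (f x - g x) - κ * ρ with hL
  have hLc : Continuous L := by fun_prop
  have hLconj : ∀ x, (L x : EReal) ≤ conj φ (-g x) := by
    intro x
    have hb : (s' x - s x) * (f x - g x) ≤ κ * |f x - g x| := by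
      refine (le_abs_self _).trans ?_
      rw [abs_mul]
      exact mul_le_mul_of_nonneg_right (hκ x) (abs_nonneg _)
    rcases le_or_gt |f x - g x| ρ with hle | hgt
    · refine le_trans (EReal.coe_le_coe_iff.2 ?_) (coe_le_conj _ (h.pair x).1)
      rw [Real.coe_toNNReal _ (h.nonneg x), hL]
      simp only
      rw [h.conj_eq]
      have hκ0 : 0 ≤ κ := (abs_nonneg _).trans (hκ x)
      nlinarith [mul_le_mul_of_nonneg_left hle hκ0]
    · refine le_trans (EReal.coe_le_coe_iff.2 ?_) (hgrowth x (g x))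
      simp only [hL]
      nlinarith [mul_le_mul_of_nonneg_right hκc (sub_nonneg.2 hgt.le)]
  have h1 : eintegral (μ : Measure X) (fun x => -conj φ (-g x)) ≤
      ((-∫ x, L x ∂(μ : Measure X) : ℝ) : EReal) := by
    rw [← integral_neg, ← eintegral_coe (integrable_of_continuous _ (by fun_prop))]
    refine eintegral_mono fun x => ?_
    rw [EReal.coe_neg]
    exact EReal.neg_le_neg_iff.2 (hLconj x)
  have hsx1 : ∫ z, E z * (g z.1 - f z.1) ∂((μ : Measure X).prod (μ : Measure X)) =
      ∫ x, s' x * (g x - f x) ∂(μ : Measure X) := by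
    rw [integral_prod _ (integrable_of_continuous _ (by fun_prop))]
    refine integral_congr_ae (ae_of_all _ fun x => ?_)
    simp only
    rw [integral_mul_const]
  have hsx2 : ∫ z, E z * (g z.2 - f z.2) ∂((μ : Measure X).prod (μ : Measure X)) =
      ∫ x, s' x * (g x - f x) ∂(μ : Measure X) := by
    rw [integral_prod_symm _ (integrable_of_continuous _ (by fun_prop))]
    refine integral_congr_ae (ae_of_all _ fun x => ?_)
    simp only
    rw [integral_mul_const]
    simp only [hE, hs']
    simp_rw [fun y => gibbs_symm hC_symm ε f y x]
  have h2 : ∫ z, E z ∂((μ : Measure X).prod (μ : Measure X)) +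
      2 / ε * ∫ x, s' x * (g x - f x) ∂(μ : Measure X) ≤
      ∫ z, Real.exp ((g z.1 + g z.2 - C z.1 z.2) / ε)
        ∂((μ : Measure X).prod (μ : Measure X)) := by
    have e : ∫ z, E z ∂((μ : Measure X).prod (μ : Measure X)) +
        2 / ε * ∫ x, s' x * (g x - f x) ∂(μ : Measure X) =
        ∫ z, (E z + (E z * (g z.1 - f z.1) / ε + E z * (g z.2 - f z.2) / ε))
          ∂((μ : Measure X).prod (μ : Measure X)) := by
      rw [integral_add (integrable_of_continuous _ (by fun_prop))
        (integrable_of_continuous _ (by fun_prop)), integral_add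
        (integrable_of_continuous _ (by fun_prop)) (integrable_of_continuous _ (by fun_prop)),
        integral_div, integral_div, hsx1, hsx2]
      ring
    rw [e]
    refine integral_mono (integrable_of_continuous _ (by fun_prop))
      (integrable_of_continuous _ (by fun_prop)) fun z => ?_
    simp only
    have e1 : (g z.1 + g z.2 - C z.1 z.2) / ε = (f z.1 + f z.2 - C z.1 z.2) / ε +
      ((g z.1 - f z.1) / ε + (g z.2 - f z.2) / ε) := by ring
    rw [e1, Real.exp_add]
    have e2 := Real.add_one_le_exp ((g z.1 - f z.1) / ε + (g z.2 - f z.2) / ε)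
    have e3 := mul_le_mul_of_nonneg_left e2 (Real.exp_pos ((f z.1 + f z.2 - C z.1 z.2) / ε)).le
    refine le_trans (le_of_eq ?_) e3
    simp only [hE, gibbs]
    ring
  have hLint : ∫ x, L x ∂(μ : Measure X) = ∫ x, P x ∂(μ : Measure X) -
      ∫ x, s' x * (g x - f x) ∂(μ : Measure X) - κ * ρ * μ.mass := by
    have e : ∀ x, L x = P x - s' x * (g x - f x) - κ * ρ := fun x => by simp only [hL]; ring
    simp_rw [e]
    rw [integral_sub (integrable_of_continuous _ (by fun_prop))
      (integrable_of_continuous _ (by fun_prop)), integral_sub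
      (integrable_of_continuous _ (by fun_prop)) (integrable_of_continuous _ (by fun_prop)),
      integral_const, smul_eq_mul, mul_comm (κ * ρ)]
    rfl
  refine (EReal.sub_le_sub h1 le_rfl).trans ?_
  rw [← EReal.coe_sub, EReal.coe_le_coe_iff, hLint]
  have h3 := mul_le_mul_of_nonneg_left h2 (show 0 ≤ ε / 2 by positivity)
  have h4 : ε / 2 * (2 / ε * ∫ x, s' x * (g x - f x) ∂(μ : Measure X)) =
      ∫ x, s' x * (g x - f x) ∂(μ : Measure X) := by field_simp
  unfold entropyValue
  linarith

theorem sinkhornEntropy_eq (hε : 0 < ε) (hC : Continuous (fun z : X × X => C z.1 z.2))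
    (hC_symm : ∀ x y, C x y = C y x) (hφ₁ : ConjStrictlyConvex φ)
    (h : IsPotential φ C ε (α : Measure X) f s P) :
    sinkhornEntropy φ C ε α = (entropyValue C ε f P α : ℝ) := by
  refine le_antisymm (h.sinkhornEntropy_le α) ?_
  obtain ⟨c, hc, hg⟩ := h.exists_growth hφ₁ one_pos
  have := h.le_sinkhornEntropy hε hC hC_symm hc.le hg α fun x => by
    rw [h.density]; simp [gibbs, marginalDensity]
  simpa using this

/-- The functional is quadratic in the measure. Symmetry of the Gibbs kernel merges the two cross
terms, turning `ε / 2` into the coefficient `ε` of `s`. -/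
theorem entropyValue_expand (hC : Continuous (fun z : X × X => C z.1 z.2))
    (hC_symm : ∀ x y, C x y = C y x) (h : IsPotential φ C ε (α : Measure X) f s P)
    {α' a b : FiniteMeasure X} {t : ℝ}
    (hα' : toSigned α' = toSigned α + t • (toSigned a - toSigned b)) :
    entropyValue C ε f P α' = entropyValue C ε f P α +
      t * pairing (toSigned a - toSigned b) ⇑(P + ε • s) +
      t ^ 2 * (ε / 2 * (∫ x, (∫ y, gibbs C ε f x y ∂(a : Measure X) -
        ∫ y, gibbs C ε f x y ∂(b : Measure X)) ∂(a : Measure X) -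
        ∫ x, (∫ y, gibbs C ε f x y ∂(a : Measure X) -
        ∫ y, gibbs C ε f x y ∂(b : Measure X)) ∂(b : Measure X))) := by
  have hE := continuous_gibbs hC ε f
  have hκ : Continuous fun x => ∫ y, gibbs C ε f x y ∂(a : Measure X) -
        ∫ y, gibbs C ε f x y ∂(b : Measure X) :=
    (continuous_integral_left hE _).sub (continuous_integral_left hE _)
  have hsx : ∀ x, ∫ y, gibbs C ε f x y ∂(α : Measure X) = s x := fun x => (h.density x).symm
  have hprod : ∀ μ ν : FiniteMeasure X, ∫ z, gibbs C ε f z.1 z.2 ∂((μ : Measure X).prod ν) =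
      ∫ x, ∫ y, gibbs C ε f x y ∂(ν : Measure X) ∂(μ : Measure X) := fun μ ν =>
    integral_prod _ (integrable_of_continuous _ hE)
  have hswap : ∀ μ : FiniteMeasure X, ∫ x, ∫ y, gibbs C ε f x y ∂(μ : Measure X) ∂(α : Measure X) =
      ∫ x, s x ∂(μ : Measure X) := fun μ => by
    rw [integral_integral_swap (integrable_of_continuous _ hE)]
    refine integral_congr_ae (ae_of_all _ fun y => ?_)
    simp only
    rw [← hsx]
    simp_rw [fun x => gibbs_symm hC_symm ε f x y]
  have hin : ∀ x, ∫ y, gibbs C ε f x y ∂(α' : Measure X) = s x +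
      t * (∫ y, gibbs C ε f x y ∂(a : Measure X) - ∫ y, gibbs C ε f x y ∂(b : Measure X)) :=
    fun x => by
      rw [integral_of_toSigned_eq hα' (show Continuous fun y => gibbs C ε f x y from
        hE.comp (Continuous.prodMk_right x)), hsx]
  have hgrad : Continuous fun x => P x + ε * s x := by fun_prop
  have hp : pairing (toSigned a - toSigned b) ⇑(P + ε • s) =
      ∫ x, P x ∂(a : Measure X) - ∫ x, P x ∂(b : Measure X) +
      ε * (∫ x, s x ∂(a : Measure X) - ∫ x, s x ∂(b : Measure X)) := by
    refine (pairing_toSigned_sub a b hgrad).trans ?_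
    rw [integral_add (integrable_of_continuous _ (by fun_prop))
      (integrable_of_continuous _ (by fun_prop)), integral_add
      (integrable_of_continuous _ (by fun_prop)) (integrable_of_continuous _ (by fun_prop)),
      integral_const_mul, integral_const_mul]
    ring
  unfold entropyValue
  rw [hprod, hprod, hp]
  simp_rw [hin, hsx]
  rw [integral_of_toSigned_eq hα' P.continuous, integral_of_toSigned_eq hα'
    (show Continuous fun x => s x + t * (∫ y, gibbs C ε f x y ∂(a : Measure X) -
      ∫ y, gibbs C ε f x y ∂(b : Measure X)) from s.continuous.add (continuous_const.mul hκ))]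
  have hadd : ∀ μ : FiniteMeasure X, ∫ x, (s x + t * (∫ y, gibbs C ε f x y ∂(a : Measure X) -
      ∫ y, gibbs C ε f x y ∂(b : Measure X))) ∂(μ : Measure X) = ∫ x, s x ∂(μ : Measure X) +
      t * ∫ x, (∫ y, gibbs C ε f x y ∂(a : Measure X) -
      ∫ y, gibbs C ε f x y ∂(b : Measure X)) ∂(μ : Measure X) := fun μ => by
    rw [integral_add (integrable_of_continuous _ s.continuous)
      ((integrable_of_continuous _ hκ).const_mul t), integral_const_mul]
  have hα0 : ∫ x, (∫ y, gibbs C ε f x y ∂(a : Measure X) -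
      ∫ y, gibbs C ε f x y ∂(b : Measure X)) ∂(α : Measure X) =
      ∫ x, s x ∂(a : Measure X) - ∫ x, s x ∂(b : Measure X) := by
    rw [integral_sub (integrable_of_continuous _ (continuous_integral_left hE _))
      (integrable_of_continuous _ (continuous_integral_left hE _)), hswap, hswap]
  rw [hadd, hadd, hadd, hα0]
  ring

/-- At `α + t δ` the entropy lies between `entropyValue` and `entropyValue` minus a multiple of `|t|
ρ`. As `ρ` is arbitrary once `t` is small, the error is `o(t)`. -/
theorem hasMeasureGradient (hε : 0 < ε) (hC : Continuous (fun z : X × X => C z.1 z.2))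
    (hC_symm : ∀ x y, C x y = C y x) (hφ₁ : ConjStrictlyConvex φ)
    (h : IsPotential φ C ε (α : Measure X) f s P) :
    HasMeasureGradient (sinkhornEntropy φ C ε) α (P + ε • s) := by
  have hval := h.sinkhornEntropy_eq hε hC hC_symm hφ₁
  refine ⟨by rw [hval]; exact EReal.coe_ne_bot _, by rw [hval]; exact EReal.coe_ne_top _,
    fun δ => ?_⟩
  obtain ⟨a, b, rfl⟩ := exists_toSigned_sub δ
  have hE := continuous_gibbs hC ε f
  set J := entropyValue C ε f P α with hJ
  set D := pairing (toSigned a - toSigned b) ⇑(P + ε • s) with hD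
  set k : X → ℝ := fun x => ∫ y, gibbs C ε f x y ∂(a : Measure X) -
        ∫ y, gibbs C ε f x y ∂(b : Measure X) with hk
  set Q : ℝ := ε / 2 * (∫ x, k x ∂(a : Measure X) - ∫ x, k x ∂(b : Measure X)) with hQ
  have hkc : Continuous k := (continuous_integral_left hE _).sub (continuous_integral_left hE _)
  obtain ⟨K, hK⟩ : ∃ K, ∀ x, |k x| ≤ K := by
    obtain ⟨K, hK⟩ := isCompact_univ.exists_bound_of_continuousOn hkc.continuousOn
    exact ⟨K, fun x => hK x (mem_univ x)⟩
  replace hK : ∀ x, |k x| ≤ |K| := fun x => (hK x).trans (le_abs_self K)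
  set B : ℝ := α.mass + a.mass + b.mass with hB
  have hB0 : 0 ≤ B := by positivity
  have key : ∀ ρ > 0, ∀ᶠ t in 𝓝 (0 : ℝ), ∀ α' : FiniteMeasure X,
      toSigned α' = toSigned α + t • (toSigned a - toSigned b) →
      ∃ v : ℝ, sinkhornEntropy φ C ε α' = v ∧ |v - J - t * D| ≤ |t| * (|t| * |Q| + |K| * B * ρ) := by
    intro ρ hρ
    obtain ⟨c, hc, hg⟩ := h.exists_growth hφ₁ hρ
    have ev1 : ∀ᶠ t in 𝓝 (0 : ℝ), |t| * |K| < c := by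
      have : Continuous fun t : ℝ => |t| * |K| := by fun_prop
      exact this.continuousAt.eventually_lt continuousAt_const (by simpa using hc)
    have ev2 : ∀ᶠ t in 𝓝 (0 : ℝ), |t| < 1 := by
      have : Continuous fun t : ℝ => |t| := by fun_prop
      exact this.continuousAt.eventually_lt continuousAt_const (by simp)
    filter_upwards [ev1, ev2] with t ht1 ht2 α' hα'
    have hin : ∀ x, ∫ y, gibbs C ε f x y ∂(α' : Measure X) - s x = t * k x := fun x => by
      rw [integral_of_toSigned_eq hα' (show Continuous fun y => gibbs C ε f x y from
        hE.comp (Continuous.prodMk_right x)), h.density]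
      simp only [hk, marginalDensity, gibbs]
      ring
    have hlow := h.le_sinkhornEntropy hε hC hC_symm ht1.le hg α' fun x => by
      rw [hin, abs_mul]; exact mul_le_mul_of_nonneg_left (hK x) (abs_nonneg t)
    have hup := h.sinkhornEntropy_le α'
    have hmass : (α'.mass : ℝ) ≤ B := by
      have := integral_of_toSigned_eq hα' (continuous_const (y := (1 : ℝ)))
      simp only [integral_const, smul_eq_mul, mul_one] at this
      change (α'.mass : ℝ) = α.mass + t * (a.mass - b.mass) at this
      rw [this, hB]
      have h1 : t * (a.mass - b.mass) ≤ |t| * (a.mass + b.mass) := by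
        refine (le_abs_self _).trans ?_
        rw [abs_mul]
        refine mul_le_mul_of_nonneg_left ?_ (abs_nonneg t)
        exact (abs_sub _ _).trans (by simp)
      nlinarith [NNReal.coe_nonneg a.mass, NNReal.coe_nonneg b.mass]
    have hexp := h.entropyValue_expand hC hC_symm hα'
    rw [← hJ, ← hD, ← hQ] at hexp
    have hnt : sinkhornEntropy φ C ε α' ≠ ⊤ := ne_top_of_le_ne_top (EReal.coe_ne_top _) hup
    have hnb : sinkhornEntropy φ C ε α' ≠ ⊥ := ne_bot_of_le_ne_bot (EReal.coe_ne_bot _) hlow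
    lift sinkhornEntropy φ C ε α' to ℝ using ⟨hnt, hnb⟩ with v
    refine ⟨v, rfl, ?_⟩
    rw [EReal.coe_le_coe_iff] at hlow hup
    have h1 : |t| * |K| * ρ * α'.mass ≤ |t| * |K| * ρ * B :=
      mul_le_mul_of_nonneg_left hmass (by positivity)
    have h2 : |t ^ 2 * Q| = |t| * (|t| * |Q|) := by rw [abs_mul, pow_two, abs_mul]; ring
    have h3 := abs_le.1 h2.le
    have h4 : 0 ≤ |t| * (|K| * B * ρ) := by positivity
    rw [abs_le]
    constructor <;> nlinarith
  classical
  -- The positive measure, if it exists, is unique by `toSigned_injective`, so the remainder is well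
  -- defined; for other `t` it is set to `0`.
  let r : ℝ → ℝ := fun t => if H : ∃ α' : FiniteMeasure X,
    toSigned α' = toSigned α + t • (toSigned a - toSigned b) then
      (sinkhornEntropy φ C ε H.choose).toReal - J - t * D else 0
  have hr : ∀ t, ∀ α' : FiniteMeasure X,
      toSigned α' = toSigned α + t • (toSigned a - toSigned b) →
      r t = (sinkhornEntropy φ C ε α').toReal - J - t * D := by
    intro t α' hα'
    have H : ∃ α' : FiniteMeasure X,
      toSigned α' = toSigned α + t • (toSigned a - toSigned b) := ⟨α', hα'⟩
    have e : H.choose = α' := toSigned_injective (H.choose_spec.trans hα'.symm)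
    simp only [r, dif_pos H, e]
  refine ⟨r, ?_, ?_⟩
  · refine Asymptotics.isLittleO_iff.2 fun c hc => ?_
    -- Chosen so that `|K| * B * ρ ≤ c / 2`; the quadratic term uses the other half.
    have hρ : 0 < c / (2 * (|K| * B + 1)) := by positivity
    have ev : ∀ᶠ t in 𝓝 (0 : ℝ), |t| * |Q| < c / 2 := by
      have : Continuous fun t : ℝ => |t| * |Q| := by fun_prop
      exact this.continuousAt.eventually_lt continuousAt_const (by simpa using hc)
    filter_upwards [key _ hρ, ev] with t ht hQt
    rw [Real.norm_eq_abs, Real.norm_eq_abs]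
    by_cases H : ∃ α' : FiniteMeasure X,
      toSigned α' = toSigned α + t • (toSigned a - toSigned b)
    · obtain ⟨α', hα'⟩ := H
      obtain ⟨v, hv, hle⟩ := ht α' hα'
      rw [hr t α' hα', hv, EReal.toReal_coe]
      refine hle.trans ?_
      rw [mul_comm]
      refine mul_le_mul_of_nonneg_right ?_ (abs_nonneg t)
      have : |K| * B * (c / (2 * (|K| * B + 1))) ≤ c / 2 := by
        have hp : 0 < |K| * B + 1 := by positivity
        rw [show |K| * B * (c / (2 * (|K| * B + 1))) = c / 2 * ((|K| * B) / (|K| * B + 1)) by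
          field_simp]
        exact mul_le_of_le_one_right (by positivity) ((div_le_one hp).2 (by linarith))
      linarith
    · simp only [r, dif_neg H, abs_zero]; positivity
  · filter_upwards [key 1 one_pos] with t ht α' hα'
    obtain ⟨v, hv, -⟩ := ht α' hα'
    rw [hr t α' hα', hv, hval, EReal.toReal_coe, ← EReal.coe_add]
    congr 1
    ring

theorem measureGradient_eq (hε : 0 < ε) (hC : Continuous (fun z : X × X => C z.1 z.2))
    (hC_symm : ∀ x y, C x y = C y x) (hφ₁ : ConjStrictlyConvex φ)
    (h : IsPotential φ C ε (α : Measure X) f s P) :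
    measureGradient (sinkhornEntropy φ C ε) α = P + ε • s := by
  have hg := h.hasMeasureGradient hε hC hC_symm hφ₁
  have hd : MeasureDifferentiableAt (sinkhornEntropy φ C ε) α := ⟨_, hg⟩
  unfold measureGradient
  rw [dif_pos hd]
  exact hd.choose_spec.unique hg

end IsPotential

end

/-! ### Comparison of the Sinkhorn and Hausdorff divergences -/

section

variable {X : Type*} [MetricSpace X] [CompactSpace X] [MeasurableSpace X] [BorelSpace X]
  {φ : ℝ≥0 → ℝ≥0∞} {C : X → X → ℝ} {ε : ℝ}

namespace IsPotential

variable {α β : FiniteMeasure X} {f s P g u Q : C(X, ℝ)}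

theorem integral_gibbs_sub_one (hC : Continuous (fun z : X × X => C z.1 z.2))
    (h : IsPotential φ C ε (α : Measure X) f s P) (μ : FiniteMeasure X) :
    ∫ z, (Real.exp ((f z.1 + f z.2 - C z.1 z.2) / ε) - 1) ∂((μ : Measure X).prod (α : Measure X)) =
      ∫ x, s x ∂(μ : Measure X) - μ.mass * α.mass := by
  have hE := continuous_gibbs hC ε f
  have h1 : ∫ z, gibbs C ε f z.1 z.2 ∂((μ : Measure X).prod (α : Measure X)) =
      ∫ x, s x ∂(μ : Measure X) := by
    rw [integral_prod _ (integrable_of_continuous _ hE)]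
    exact integral_congr_ae (ae_of_all _ fun x => (h.density x).symm)
  change ∫ z, (gibbs C ε f z.1 z.2 - 1) ∂((μ : Measure X).prod (α : Measure X)) = _
  rw [← h1, integral_sub (integrable_of_continuous _ hE) (integrable_const _), integral_const,
    smul_eq_mul, mul_one, ← univ_prod_univ, measureReal_prod_prod]
  rfl

theorem integral_gibbs_sub_one' (hC : Continuous (fun z : X × X => C z.1 z.2))
    (hC_symm : ∀ x y, C x y = C y x)
    (h : IsPotential φ C ε (α : Measure X) f s P) (μ : FiniteMeasure X) :
    ∫ z, (Real.exp ((f z.1 + f z.2 - C z.1 z.2) / ε) - 1) ∂((α : Measure X).prod (μ : Measure X)) =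
      ∫ x, s x ∂(μ : Measure X) - μ.mass * α.mass := by
  rw [← h.integral_gibbs_sub_one hC μ, ← integral_prod_swap]
  simp only [Prod.fst_swap, Prod.snd_swap]
  refine integral_congr_ae (ae_of_all _ fun z => ?_)
  simp only
  rw [hC_symm, add_comm (f z.2)]

theorem hausdorffDiv_eq (hε : 0 < ε) (hC : Continuous (fun z : X × X => C z.1 z.2))
    (hC_symm : ∀ x y, C x y = C y x) (hφ₁ : ConjStrictlyConvex φ)
    (h : IsPotential φ C ε (α : Measure X) f s P) (h' : IsPotential φ C ε (β : Measure X) g u Q) :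
    hausdorffDiv φ C ε α β =
      ∫ x, P x ∂(α : Measure X) - ∫ x, Q x ∂(α : Measure X) - ∫ x, P x ∂(β : Measure X) +
        ∫ x, Q x ∂(β : Measure X) + ε * (∫ x, s x ∂(α : Measure X) - ∫ x, u x ∂(α : Measure X) -
        ∫ x, s x ∂(β : Measure X) + ∫ x, u x ∂(β : Measure X)) := by
  have key : ∀ μ : FiniteMeasure X, ∫ x, (P + ε • s - (Q + ε • u)) x ∂(μ : Measure X) =
      ∫ x, P x ∂(μ : Measure X) + ε * ∫ x, s x ∂(μ : Measure X) -
        (∫ x, Q x ∂(μ : Measure X) + ε * ∫ x, u x ∂(μ : Measure X)) := by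
    intro μ
    have e : ∀ x, (P + ε • s - (Q + ε • u)) x = P x + ε * s x - (Q x + ε * u x) := fun x => rfl
    simp_rw [e]
    rw [integral_sub (integrable_of_continuous _ (by fun_prop))
      (integrable_of_continuous _ (by fun_prop)), integral_add
      (integrable_of_continuous _ (by fun_prop)) (integrable_of_continuous _ (by fun_prop)),
      integral_add (integrable_of_continuous _ (by fun_prop))
      (integrable_of_continuous _ (by fun_prop)), integral_const_mul, integral_const_mul]
  unfold hausdorffDiv symmBregman
  rw [h.measureGradient_eq hε hC hC_symm hφ₁, h'.measureGradient_eq hε hC hC_symm hφ₁]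
  rw [← ContinuousMap.coe_sub, pairing_toSigned_sub α β (ContinuousMap.continuous _), key, key]
  ring

theorem half_hausdorffDiv_le_sinkhornDiv (hε : 0 < ε)
    (hC : Continuous (fun z : X × X => C z.1 z.2)) (hC_symm : ∀ x y, C x y = C y x)
    (hφ₁ : ConjStrictlyConvex φ)
    (h : IsPotential φ C ε (α : Measure X) f s P) (h' : IsPotential φ C ε (β : Measure X) g u Q)
    (hαβ : otCost φ C ε α β ≠ ⊤) :
    ((1 / 2 * hausdorffDiv φ C ε α β : ℝ) : EReal) ≤ sinkhornDiv φ C ε α β := by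
  have d1 := dual_le_otCost hε hC α β f f P P h.fenchel h.fenchel
  have d2 := dual_le_otCost hε hC α β g g Q Q h'.fenchel h'.fenchel
  have p1 := h.otCost_le hε hC hC_symm
  have p2 := h'.otCost_le hε hC hC_symm
  rw [h.integral_gibbs_sub_one' hC hC_symm] at d1
  rw [h'.integral_gibbs_sub_one hC] at d2
  rw [h.integral_gibbs_sub_one hC] at p1
  rw [h'.integral_gibbs_sub_one hC] at p2
  unfold sinkhornDiv
  lift otCost φ C ε α β to ℝ using ⟨hαβ, otCost_ne_bot hε hC α β⟩ with o
  lift otCost φ C ε α α to ℝ using ⟨ne_top_of_le_ne_top (EReal.coe_ne_top _) p1,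
    otCost_ne_bot hε hC α α⟩ with a
  lift otCost φ C ε β β to ℝ using ⟨ne_top_of_le_ne_top (EReal.coe_ne_top _) p2,
    otCost_ne_bot hε hC β β⟩ with b
  rw [EReal.coe_le_coe_iff] at d1 d2 p1 p2
  rw [← EReal.coe_mul, ← EReal.coe_mul, ← EReal.coe_sub, ← EReal.coe_sub, ← EReal.coe_add,
    EReal.coe_le_coe_iff, h.hausdorffDiv_eq hε hC hC_symm hφ₁ h']
  -- Half the sum of `d1` and `d2`, minus half of `p1` and of `p2`. The mass products cancel against
  -- `ε / 2 * (m(α) - m(β)) ^ 2`.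
  nlinarith

/-- The mixed Gibbs integral controls the difference of conjugates at two potentials. -/
theorem mul_density_sub_le (hε : 0 < ε)
    (h : IsPotential φ C ε (α : Measure X) f s P) (h' : IsPotential φ C ε (β : Measure X) g u Q)
    (x : X) :
    ε * (u x - ∫ y, Real.exp ((f x + g y - C x y) / ε) ∂(β : Measure X)) ≤ P x - Q x := by
  have h1 := h.fenchel x _ (h'.pair x).1
  rw [Real.coe_toNNReal _ (h'.nonneg x)] at h1
  have h2 := h'.conj_eq x
  -- With `x` fixed, replacing `g x` by `f x` only rescales the density `u x`.
  have h3 : ∫ y, Real.exp ((f x + g y - C x y) / ε) ∂(β : Measure X) =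
      Real.exp ((f x - g x) / ε) * u x := by
    rw [h'.density, marginalDensity, ← integral_const_mul]
    simp_rw [← Real.exp_add, ← add_div]
    refine integral_congr_ae (ae_of_all _ fun y => ?_)
    simp only
    congr 2
    ring
  have h4 := Real.add_one_le_exp ((f x - g x) / ε)
  have h5 := mul_le_mul_of_nonneg_left h4 (mul_nonneg hε.le (h'.nonneg x))
  have h6 : ε * u x * ((f x - g x) / ε + 1) = u x * (f x - g x) + ε * u x := by field_simp
  rw [h3]
  linarith

/-- The kernel is tested on `exp(f/ε) α - exp(g/ε) β`: the diagonal terms give the integrals of `s`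
and `u`, and the mixed ones are controlled by `mul_density_sub_le` in both orders. -/
theorem hausdorffDiv_nonneg (hε : 0 < ε)
    (hC : Continuous (fun z : X × X => C z.1 z.2)) (hC_symm : ∀ x y, C x y = C y x)
    (hφ₁ : ConjStrictlyConvex φ)
    (h : IsPotential φ C ε (α : Measure X) f s P) (h' : IsPotential φ C ε (β : Measure X) g u Q)
    (hk : IsPositiveKernel (fun x y : X => Real.exp (-C x y / ε))) :
    0 ≤ hausdorffDiv φ C ε α β := by
  have hwc : ∀ f : C(X, ℝ), Continuous fun x => Real.exp (f x / ε) := fun f => by fun_prop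
  let μ : FiniteMeasure X := ⟨_, isFiniteMeasure_withDensity_continuous (α : Measure X) (hwc f)⟩
  let ν : FiniteMeasure X := ⟨_, isFiniteMeasure_withDensity_continuous (β : Measure X) (hwc g)⟩
  have hwd : ∀ (γ : FiniteMeasure X) (f : C(X, ℝ)) (v : X → ℝ),
      ∫ x, v x ∂((γ : Measure X).withDensity fun x => ENNReal.ofReal (Real.exp (f x / ε))) =
      ∫ x, Real.exp (f x / ε) * v x ∂(γ : Measure X) := by
    intro γ f v
    rw [integral_withDensity_eq_integral_toReal_smul (hwc f).measurable.ennreal_ofReal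
      (ae_of_all _ fun z => by simp)]
    simp_rw [ENNReal.toReal_ofReal (Real.exp_pos _).le, smul_eq_mul]
  let A : FiniteMeasure X → C(X, ℝ) → X → ℝ := fun γ f x =>
    ∫ y, Real.exp ((f y - C x y) / ε) ∂(γ : Measure X)
  have hA : ∀ γ f, Continuous (A γ f) := fun γ f => by
    have hc : Continuous fun z : X × X => Real.exp ((f z.2 - C z.1 z.2) / ε) := by fun_prop
    exact continuous_integral_left hc _
  have hin : ∀ x, pairing (toSigned μ - toSigned ν) (fun y => Real.exp (-C x y / ε)) =
      A α f x - A β g x := by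
    intro x
    have hc : Continuous fun y => C x y := hC.comp (Continuous.prodMk_right x)
    rw [pairing_toSigned_sub μ ν (show Continuous fun y => Real.exp (-C x y / ε) by fun_prop)]
    change ∫ _, _ ∂((α : Measure X).withDensity _) - ∫ _, _ ∂((β : Measure X).withDensity _) = _
    rw [hwd, hwd]
    simp_rw [← Real.exp_add, ← add_div, ← sub_eq_add_neg]
    rfl
  have hpos := hk (toSigned μ - toSigned ν)
  simp_rw [hin] at hpos
  rw [pairing_toSigned_sub μ ν (show Continuous fun x => A α f x - A β g x from
    (hA α f).sub (hA β g))] at hpos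
  change 0 ≤ ∫ _, _ ∂((α : Measure X).withDensity _) - ∫ _, _ ∂((β : Measure X).withDensity _)
    at hpos
  rw [hwd, hwd] at hpos
  have hAW : ∀ γ (f g : C(X, ℝ)) x, Real.exp (f x / ε) * A γ g x =
      ∫ y, Real.exp ((f x + g y - C x y) / ε) ∂(γ : Measure X) := by
    intro γ f g x
    simp only [A]
    rw [← integral_const_mul]
    simp_rw [← Real.exp_add, ← add_div, add_sub_assoc]
  have hAs : ∀ x, Real.exp (f x / ε) * A α f x = s x := fun x => by
    rw [hAW, h.density, marginalDensity]
  have hBu : ∀ x, Real.exp (g x / ε) * A β g x = u x := fun x => by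
    rw [hAW, h'.density, marginalDensity]
  have hAc := hA α f
  have hBc := hA β g
  have e1 : ∫ x, Real.exp (f x / ε) * (A α f x - A β g x) ∂(α : Measure X) =
      ∫ x, s x ∂(α : Measure X) - ∫ x, Real.exp (f x / ε) * A β g x ∂(α : Measure X) := by
    simp_rw [mul_sub, hAs]
    exact integral_sub (integrable_of_continuous _ (by fun_prop))
      (integrable_of_continuous _ (by fun_prop))
  have e2 : ∫ x, Real.exp (g x / ε) * (A α f x - A β g x) ∂(β : Measure X) =
      ∫ x, Real.exp (g x / ε) * A α f x ∂(β : Measure X) - ∫ x, u x ∂(β : Measure X) := by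
    simp_rw [mul_sub, hBu]
    exact integral_sub (integrable_of_continuous _ (by fun_prop))
      (integrable_of_continuous _ (by fun_prop))
  rw [e1, e2] at hpos
  have i1 : ε * (∫ x, u x ∂(α : Measure X) - ∫ x, Real.exp (f x / ε) * A β g x ∂(α : Measure X)) ≤
      ∫ x, P x ∂(α : Measure X) - ∫ x, Q x ∂(α : Measure X) := by
    rw [← integral_sub (integrable_of_continuous _ (by fun_prop))
      (integrable_of_continuous _ (by fun_prop)), ← integral_sub
      (integrable_of_continuous _ (by fun_prop)) (integrable_of_continuous _ (by fun_prop)),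
      ← integral_const_mul]
    refine integral_mono (integrable_of_continuous _ (by fun_prop))
      (integrable_of_continuous _ (by fun_prop)) fun x => ?_
    simp only [hAW]
    exact mul_density_sub_le hε h h' x
  have i2 : ε * (∫ x, s x ∂(β : Measure X) - ∫ x, Real.exp (g x / ε) * A α f x ∂(β : Measure X)) ≤
      ∫ x, Q x ∂(β : Measure X) - ∫ x, P x ∂(β : Measure X) := by
    rw [← integral_sub (integrable_of_continuous _ (by fun_prop))
      (integrable_of_continuous _ (by fun_prop)), ← integral_sub
      (integrable_of_continuous _ (by fun_prop)) (integrable_of_continuous _ (by fun_prop)),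
      ← integral_const_mul]
    refine integral_mono (integrable_of_continuous _ (by fun_prop))
      (integrable_of_continuous _ (by fun_prop)) fun x => ?_
    simp only [hAW]
    exact mul_density_sub_le hε h' h x
  rw [h.hausdorffDiv_eq hε hC hC_symm hφ₁ h']
  have := mul_nonneg hε.le hpos
  linarith

end IsPotential

end

end UnbalancedOT

/-! ### Conclusion from the potentials of the two measures -/

open UnbalancedOT
theorem mainTheorem12 {X : Type*} [MetricSpace X] [CompactSpace X] [MeasurableSpace X]
    [BorelSpace X]
    (φ : ℝ≥0 → ℝ≥0∞) (hφ : IsEntropyFunction φ)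
    (hφ₁ : ConjStrictlyConvex φ) (hφ₂ : ConjExtremeSlopes φ)
    (C : X → X → ℝ) (hC_cont : Continuous (fun z : X × X => C z.1 z.2))
    (hC_symm : ∀ x y, C x y = C y x) (hC_diag : ∀ x, C x x = 0)
    (γ : ℝ≥0) (hC_lip : ∀ x y z, |C x z - C y z| ≤ γ * dist x y)
    (ε : ℝ) (hε : 0 < ε)
    (α β : FiniteMeasure X) (hα : α ≠ 0) (hβ : β ≠ 0) :
    (otCost φ C ε α β ≠ ⊥ ∧ otCost φ C ε α β ≠ ⊤) ∧
    MeasureDifferentiableAt (sinkhornEntropy φ C ε) α ∧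
    MeasureDifferentiableAt (sinkhornEntropy φ C ε) β ∧
    ((1 / 2 * hausdorffDiv φ C ε α β : ℝ) : EReal) ≤ sinkhornDiv φ C ε α β ∧
    (IsPositiveKernel (fun x y : X => Real.exp (-C x y / ε)) →
      0 ≤ 1 / 2 * hausdorffDiv φ C ε α β) := by
  have : NeZero (α : Measure X) := ⟨fun h => hα (Subtype.ext h)⟩
  have : NeZero (β : Measure X) := ⟨fun h => hβ (Subtype.ext h)⟩
  obtain ⟨f, s, P, h⟩ := exists_isPotential hφ hε hC_cont hC_diag hC_lip (α : Measure X)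
  obtain ⟨g, u, Q, h'⟩ := exists_isPotential hφ hε hC_cont hC_diag hC_lip (β : Measure X)
  have htop : otCost φ C ε α β ≠ ⊤ := otCost_ne_top hφ hφ₂ α β hα hβ
  refine ⟨⟨otCost_ne_bot hε hC_cont α β, htop⟩, ⟨_, h.hasMeasureGradient hε hC_cont hC_symm hφ₁⟩,
    ⟨_, h'.hasMeasureGradient hε hC_cont hC_symm hφ₁⟩,
    h.half_hausdorffDiv_le_sinkhornDiv hε hC_cont hC_symm hφ₁ h' htop, fun hk => ?_⟩
  exact mul_nonneg (by norm_num) (h.hausdorffDiv_nonneg hε hC_cont hC_symm hφ₁ h' hk)
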